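/- Let $0<H<1$, $0<K\le 1$ and $T\ge 0$. Let $W=W^{H,K}=\{W_t,\ t\ge 0\}$ be a bifractional Brownian motion, that is, a centered Gaussian process with covariance $$E[W_sW_t]=\frac1{2^K}\left[(t^{2H}+s^{2H})^K-|s-t|^{2HK}\right],$$ and let $Y^{(2)}=2^{-K/2}B$, where $B=W^{HK}$ is a fractional Brownian motion with Hurst index $HK$, that is, a centered Gaussian process $\{B_t,\ t\ge0\}$ with covariance $\frac12\left(t^{2HK}+s^{2HK}-|t-s|^{2HK}\right)$. ($W$ and $B$ may live on different probability spaces.) Assume that the sample paths of $W$ and $B$ over $[0,T]$ are almost surely continuous. Then the following hold. 1. For every continuous $m:[0,T]\to\mathbb R$ and every $c\in\mathbb R$, $$E\Big[\sup_{0\le t\le T}\max(W_t+m(t),c)\Big]\ \ge\ E\Big[\sup_{0\le t\le T}\max(Y^{(2)}_t+m(t),c)\Big],$$ both expectations being finite. 2. For every continuous $m:[0,T]\to\mathbb R$ and every non-decreasing convex $g:\mathbb R\to\mathbb R$, $$E\Big[g\Big(\sup_{0\le t\le T}(W_t+m(t))\Big)\Big]\ \ge\ E\Big[g\Big(\sup_{0\le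 t\le T}(Y^{(2)}_t+m(t))\Big)\Big],$$ where both expectations are well defined in $(-\infty,\infty]$. 3. For every $0\le t\le T$, $$\int_t^\infty P\Big(\sup_{0\le s\le T}W_s>u\Big)\,du\ \ge\ \int_t^\infty P\Big(\sup_{0\le s\le T}Y^{(2)}_s>u\Big)\,du,$$ both integrals being finite; or equivalently, for every $0\le t\le T$, $$E\Big[\Big(\sup_{0\le s\le T}W_s-t\Big)_+\Big]\ \ge\ E\Big[\Big(\sup_{0\le s\le T}Y^{(2)}_s-t\Big)_+\Big],$$ because $\int_t^\infty P(\sup_{0\le s\le T} Z_s>u)\,du=E[(\sup_{0\le s\le T} Z_s-t)_+]$ for $Z=W$ and for $Z=Y^{(2)}$. -/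

import Mathlib

open MeasureTheory ProbabilityTheory
open scoped NNReal ENNReal

/-- Covariance function of fractional Brownian motion with Hurst index `H`. -/
noncomputable def fbmCov (H : ℝ) (s t : ℝ≥0) : ℝ :=
  (1 / 2) * ((t : ℝ) ^ (2 * H) + (s : ℝ) ^ (2 * H) - |(t : ℝ) - (s : ℝ)| ^ (2 * H))

/-- Covariance function of bifractional Brownian motion with parameters `H` and `K`. -/
noncomputable def bifbmCov (H K : ℝ) (s t : ℝ≥0) : ℝ :=
  (1 / (2 : ℝ) ^ K) *
    (((t : ℝ) ^ (2 * H) + (s : ℝ) ^ (2 * H)) ^ K - |(s : ℝ) - (t : ℝ)| ^ (2 * H * K))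

/-- `X` is a centered Gaussian process on `[0, ∞)` with covariance function `C`. -/
structure IsCenteredGaussianWithCov {Ω : Type*} [MeasurableSpace Ω]
    (X : ℝ≥0 → Ω → ℝ) (P : Measure Ω) (C : ℝ≥0 → ℝ≥0 → ℝ) : Prop where
  isGaussianProcess : IsGaussianProcess X P
  centered : ∀ t, ∫ ω, X t ω ∂P = 0
  covariance_eq : ∀ s t, ∫ ω, X s ω * X t ω ∂P = C s t

/-- `B` is a fractional Brownian motion with Hurst index `H`. -/
def IsFBM {Ω : Type*} [MeasurableSpace Ω] (H : ℝ) (B : ℝ≥0 → Ω → ℝ) (P : Measure Ω) : Prop :=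
  IsCenteredGaussianWithCov B P (fbmCov H)

/-- `W` is a bifractional Brownian motion with parameters `H` and `K`. -/
def IsBifBM {Ω : Type*} [MeasurableSpace Ω] (H K : ℝ) (W : ℝ≥0 → Ω → ℝ) (P : Measure Ω) : Prop :=
  IsCenteredGaussianWithCov W P (bifbmCov H K)

/-- The sample paths of `X` over `[0, T]` are almost surely continuous. -/
def ContinuousPathsOn {Ω : Type*} [MeasurableSpace Ω] (T : ℝ≥0) (X : ℝ≥0 → Ω → ℝ)
    (P : Measure Ω) : Prop :=
  ∀ᵐ ω ∂P, ContinuousOn (fun t => X t ω) (Set.Icc 0 T)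

/-- `sup_{0 ≤ t ≤ T} f t`. It is only applied to functions that are continuous on `[0, T]`
for almost every outcome, hence bounded there. -/
noncomputable def supIcc (T : ℝ≥0) (f : ℝ≥0 → ℝ) : ℝ :=
  ⨆ t : Set.Icc (0 : ℝ≥0) T, f t

/-- The expectation `E[f⁺] - E[f⁻]` with values in the extended reals. It is meaningful as soon
as one of the two parts is finite. -/
noncomputable def extExpectation {Ω : Type*} [MeasurableSpace Ω] (P : Measure Ω)
    (f : Ω → ℝ) : EReal :=
  ((∫⁻ ω, ENNReal.ofReal (f ω) ∂P : ℝ≥0∞) : EReal)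
    - ((∫⁻ ω, ENNReal.ofReal (-f ω) ∂P : ℝ≥0∞) : EReal)

/-! Everything follows from an ordering of increments: the scaled fractional Brownian motion `Y` has
increment variances no larger than those of `W`, and smaller variances as well. With a = t^(2H), b =
s^(2H) and d = |t - s|^(2H), the increment inequality reads 2(a+b)^K ≤ (2a)^K + (2b)^K + d^K. Since
(√a - √b)² ≤ d, it becomes a one-parameter inequality, which Bernoulli's inequality reduces to a
rational one (`two_le_rpow_add_rpow_add_rpow`).

The Sudakov–Fernique inequality turns ordered increments into ordered expected maxima. The maximum
is replaced by log-sum-exp, whose Hessian is the covariance form of the softmax weights and so sees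
only differences of coordinates. To second order, a small Gaussian perturbation raises its
expectation by a nonnegative combination of increment variances, with a cubic error. A centered
Gaussian vector is a sum of n independent copies of itself scaled by n^(-1/2). Exchanging these one
by one costs n · O(n^(-3/2)), which vanishes (`integral_comp_smul_le_of_small`). Rescaling then
recovers the maximum.

The truncation level c is treated as one more coordinate: the zero variable with drift c. Increments
against it are variances, hence the need for the variance comparison. Maxima over a dense sequence
pass to the supremum over [0, T] by dominated convergence, the envelope coming from a dimension-free
form of Fernique's theorem.

Finally, the functions max(x, c) generate the increasing convex order: a non-decreasing convex g is
a limit of non-decreasing piecewise affine minorants, which yields the second claim by Fatou's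
lemma. The third is the case m = 0, c = t combined with the layer-cake formula. -/

/-! ### Comparison of the covariances. -/

lemma div_one_add_mul_le_rpow {x κ : ℝ} (hx : -1 < x) (hκ0 : 0 ≤ κ) (hκ1 : κ ≤ 1) :
    (1 + x) / (1 + κ * x) ≤ (1 + x) ^ (1 - κ) := by
  have h1 : 0 < 1 + x := by linarith
  have h2 : (1 + x) ^ κ ≤ 1 + κ * x := rpow_one_add_le_one_add_mul_self hx.le hκ0 hκ1
  rw [Real.rpow_sub h1, Real.rpow_one]
  exact div_le_div_of_nonneg_left h1.le (Real.rpow_pos_of_pos h1 _) h2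

/-- With κ = 1 - K, Bernoulli's inequality bounds each power (1+x)^K below by (1+x)/(1+κx). The
first two terms then fall short of 2 by at most 2κy²/(1+κ), and the third makes up for it. The
endpoints y = 1 and z = 0 are treated directly. -/
lemma two_le_rpow_add_rpow_add_rpow {K y z : ℝ} (hK0 : 0 < K) (hK1 : K ≤ 1) (hy0 : 0 ≤ y)
    (hy1 : y ≤ 1) (hz0 : 0 ≤ z) (hz1 : z ≤ 1) (hyz : y ^ 2 = z * (2 - z)) :
    2 ≤ (1 + y) ^ K + (1 - y) ^ K + z ^ K := by
  rcases hy1.eq_or_lt with rfl | hy1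
  · have : z = 1 := by nlinarith
    subst this
    have := Real.one_le_rpow (show (1:ℝ) ≤ 1 + 1 by norm_num) hK0.le
    have := Real.rpow_nonneg (show (0:ℝ) ≤ 1 - 1 by norm_num) K
    simp only [Real.one_rpow]
    linarith
  rcases hz0.eq_or_lt with rfl | hz0
  · have : y = 0 := by nlinarith
    subst this
    simp [Real.zero_rpow hK0.ne']
    norm_num
  obtain ⟨κ, rfl⟩ : ∃ κ, K = 1 - κ := ⟨1 - K, by ring⟩
  have hκ0 : 0 ≤ κ := by linarith
  have hκ1 : κ < 1 := by linarith
  have h1 := div_one_add_mul_le_rpow (x := y) (by linarith) hκ0 hκ1.le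
  have h2 := div_one_add_mul_le_rpow (x := -y) (by linarith) hκ0 hκ1.le
  have h3 := div_one_add_mul_le_rpow (x := z - 1) (by linarith) hκ0 hκ1.le
  rw [← sub_eq_add_neg, mul_neg, ← sub_eq_add_neg] at h2
  rw [add_sub_cancel] at h3
  have d1 : 0 < 1 + κ * y := by positivity
  have hκy : κ * y < 1 := by nlinarith
  have d2 : 0 < 1 - κ * y := by linarith
  have d3 : 0 < 1 + κ * (z - 1) := by nlinarith
  -- The exact deficit is 2κ(1-κ)y²/(1-κ²y²), and 1-κ² ≤ 1-κ²y² because y² ≤ 1.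
  have e1 : 2 - 2 * κ * y ^ 2 / (1 + κ) ≤ (1 + y) / (1 + κ * y) + (1 - y) / (1 - κ * y) := by
    rw [div_add_div _ _ d1.ne' d2.ne', sub_le_iff_le_add, ← sub_le_iff_le_add',
      show (2:ℝ) - ((1 + y) * (1 - κ * y) + (1 + κ * y) * (1 - y)) / ((1 + κ * y) * (1 - κ * y))
        = 2 * κ * y ^ 2 * (1 - κ) / ((1 + κ * y) * (1 - κ * y)) by
          rw [eq_div_iff (by positivity), sub_mul, div_mul_cancel₀ _ (by positivity)]; ring,
      div_le_div_iff₀ (by positivity) (by positivity)]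
    have : 0 ≤ 2 * κ * y ^ 2 := by positivity
    have h : (1 - κ) * (1 + κ) ≤ (1 + κ * y) * (1 - κ * y) := by
      nlinarith [mul_nonneg (sq_nonneg κ) (show 0 ≤ 1 - y ^ 2 by nlinarith)]
    nlinarith
  -- Substituting y² = z(2-z) lets the factor z cancel, leaving a quadratic inequality in z.
  have e2 : 2 * κ * y ^ 2 / (1 + κ) ≤ z / (1 + κ * (z - 1)) := by
    rw [hyz, div_le_div_iff₀ (by positivity) d3]
    have hw : 2 * κ * (2 - z) * (1 + κ * (z - 1)) ≤ 1 + κ := by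
      nlinarith [mul_nonneg hκ0 hκ0, mul_nonneg hκ0 (sub_nonneg.2 hκ1.le),
        mul_nonneg (mul_nonneg hκ0 hκ0) (sq_nonneg (1 - z)), sq_nonneg (1 - κ), mul_nonneg hκ0 hz0.le]
    nlinarith
  linarith

/-- By homogeneity one divides by (a+b)^K. Then y = (a-b)/(a+b) and z = (√a-√b)²/(a+b) = 1 -
2√(ab)/(a+b) satisfy y² = 1-(1-z)², the relation required above; d enters only through monotonicity.
-/
lemma two_mul_add_rpow_le {K a b d : ℝ} (hK0 : 0 < K) (hK1 : K ≤ 1) (ha : 0 ≤ a) (hb : 0 ≤ b)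
    (hd : (√a - √b) ^ 2 ≤ d) :
    2 * (a + b) ^ K ≤ (2 * a) ^ K + (2 * b) ^ K + d ^ K := by
  wlog hab : b ≤ a generalizing a b
  · have := this hb ha (by rwa [← neg_sub, neg_sq]) (le_of_not_ge hab)
    rw [add_comm a b]; linarith
  rcases (add_nonneg ha hb).eq_or_lt with h0 | h0
  · have := Real.rpow_nonneg (show 0 ≤ 2 * a by linarith) K
    have := Real.rpow_nonneg (show 0 ≤ 2 * b by linarith) K
    have := Real.rpow_nonneg ((sq_nonneg _).trans hd) K
    rw [← h0, Real.zero_rpow hK0.ne']; linarith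
  have hsa := Real.sq_sqrt ha
  have hsb := Real.sq_sqrt hb
  set z := (√a - √b) ^ 2 / (a + b) with hz
  have key := two_le_rpow_add_rpow_add_rpow (y := (a - b) / (a + b)) (z := z) hK0 hK1
    (div_nonneg (by linarith) h0.le) ((div_le_one h0).2 (by linarith)) (by positivity)
    ((div_le_one h0).2 (by nlinarith [Real.sqrt_nonneg a, Real.sqrt_nonneg b]))
    (by rw [hz]; field_simp
        rw [show a - b = √a ^ 2 - √b ^ 2 by rw [hsa, hsb],
          show a + b = √a ^ 2 + √b ^ 2 by rw [hsa, hsb]]; ring)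
  have e1 : 1 + (a - b) / (a + b) = 2 * a / (a + b) := by field_simp; ring
  have e2 : 1 - (a - b) / (a + b) = 2 * b / (a + b) := by field_simp; ring
  rw [e1, e2, hz, Real.div_rpow (by linarith) h0.le, Real.div_rpow (by linarith) h0.le,
    Real.div_rpow (by positivity) h0.le, ← add_div, ← add_div,
    le_div_iff₀ (Real.rpow_pos_of_pos h0 _)] at key
  exact key.trans (by gcongr)

/-- This is |t^H - s^H| ≤ |t - s|^H, the subadditivity of x ↦ x^H for H ≤ 1, squared. -/
lemma sq_sqrt_rpow_sub_sqrt_rpow_le {H s t : ℝ} (hH0 : 0 < H) (hH1 : H < 1) (hs : 0 ≤ s)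
    (ht : 0 ≤ t) : (√(t ^ (2 * H)) - √(s ^ (2 * H))) ^ 2 ≤ |t - s| ^ (2 * H) := by
  have e : ∀ x : ℝ, 0 ≤ x → √(x ^ (2 * H)) = x ^ H := fun x hx => by
    rw [Real.sqrt_eq_rpow, ← Real.rpow_mul hx]; congr 1; ring
  rw [e t ht, e s hs, show (2 : ℝ) * H = H * 2 by ring, Real.rpow_mul (abs_nonneg _),
    Real.rpow_two, sq_le_sq, abs_of_nonneg (Real.rpow_nonneg (abs_nonneg _) _)]
  have sub : ∀ x y : ℝ, 0 ≤ x → 0 ≤ y → x ^ H - y ^ H ≤ |x - y| ^ H := fun x y hx hy => by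
    have h1 : x ^ H ≤ (y + |x - y|) ^ H :=
      Real.rpow_le_rpow hx (by linarith [le_abs_self (x - y)]) hH0.le
    have h2 := Real.rpow_add_le_add_rpow hy (abs_nonneg (x - y)) hH0.le hH1.le
    linarith
  rw [abs_le]
  have := sub t s ht hs
  have := sub s t hs ht
  rw [abs_sub_comm s t] at this
  constructor <;> linarith

lemma bifbmCov_self {H K : ℝ} (hH0 : 0 < H) (hK0 : 0 < K) (t : ℝ≥0) :
    bifbmCov H K t t = (t : ℝ) ^ (2 * H * K) := by
  have h : (0:ℝ) < 2 ^ K := by positivity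
  rw [bifbmCov, sub_self, abs_zero, Real.zero_rpow (by positivity), ← two_mul,
    Real.mul_rpow (by norm_num) (by positivity), ← Real.rpow_mul t.coe_nonneg]
  field_simp
  simp

lemma fbmCov_self {H : ℝ} (hH0 : 0 < H) (t : ℝ≥0) : fbmCov H t t = (t : ℝ) ^ (2 * H) := by
  rw [fbmCov, sub_self, abs_zero, Real.zero_rpow (by positivity)]
  ring

lemma fbmCov_increment {H : ℝ} (hH0 : 0 < H) (s t : ℝ≥0) :
    fbmCov H s s + fbmCov H t t - 2 * fbmCov H s t = |(t : ℝ) - s| ^ (2 * H) := by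
  rw [fbmCov_self hH0, fbmCov_self hH0, fbmCov]
  ring

lemma fbmCov_increment_le_bifbmCov_increment {H K : ℝ} (hH0 : 0 < H) (hH1 : H < 1) (hK0 : 0 < K)
    (hK1 : K ≤ 1) (s t : ℝ≥0) :
    (2 : ℝ) ^ (-K) *
        (fbmCov (H * K) s s + fbmCov (H * K) t t - 2 * fbmCov (H * K) s t) ≤
      bifbmCov H K s s + bifbmCov H K t t - 2 * bifbmCov H K s t := by
  have h2K : (0:ℝ) < 2 ^ K := by positivity
  rw [fbmCov_increment (by positivity), bifbmCov_self hH0 hK0, bifbmCov_self hH0 hK0, bifbmCov,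
    abs_sub_comm (s : ℝ), ← mul_assoc 2 H K]
  have key := two_mul_add_rpow_le hK0 hK1 (Real.rpow_nonneg t.2 (2 * H))
    (Real.rpow_nonneg s.2 (2 * H)) (sq_sqrt_rpow_sub_sqrt_rpow_le hH0 hH1 s.2 t.2)
  rw [Real.mul_rpow (by norm_num) (Real.rpow_nonneg t.2 _),
    Real.mul_rpow (by norm_num) (Real.rpow_nonneg s.2 _), ← Real.rpow_mul t.2,
    ← Real.rpow_mul s.2, ← Real.rpow_mul (abs_nonneg _)] at key
  simp only [NNReal.val_eq_coe] at key
  rw [Real.rpow_neg (by norm_num), ← mul_le_mul_iff_right₀ h2K]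
  field_simp
  linarith

/-- Needed for increments against the constant coordinate that carries the truncation level. -/
lemma fbmCov_self_le_bifbmCov_self {H K : ℝ} (hH0 : 0 < H) (hK0 : 0 < K) (t : ℝ≥0) :
    (2 : ℝ) ^ (-K) * fbmCov (H * K) t t ≤ bifbmCov H K t t := by
  rw [fbmCov_self (by positivity), bifbmCov_self hH0 hK0, ← mul_assoc 2 H K]
  exact mul_le_of_le_one_left (Real.rpow_nonneg t.2 _)
    (Real.rpow_le_one_of_one_le_of_nonpos (by norm_num) (by linarith))

/-! ### Second-order expansion of log-sum-exp with a cubic remainder. -/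

lemma abs_log_one_add_sub_le {u : ℝ} (hu : |u| ≤ 1 / 2) :
    |Real.log (1 + u) - (u - u ^ 2 / 2)| ≤ 2 * |u| ^ 3 := by
  have h := Real.abs_log_sub_add_sum_range_le (x := -u) (by rw [abs_neg]; linarith) 2
  rw [abs_neg, sub_neg_eq_add] at h
  norm_num [Finset.sum_range_succ] at h
  rw [show Real.log (1 + u) - (u - u ^ 2 / 2) = -u + u ^ 2 / 2 + Real.log (1 + u) by ring]
  refine h.trans ?_
  rw [div_le_iff₀ (by linarith)]
  nlinarith [pow_nonneg (abs_nonneg u) 3]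

lemma abs_exp_sub_taylor_two_le {v : ℝ} (hv : |v| ≤ 1) :
    |Real.exp v - (1 + v + v ^ 2 / 2)| ≤ |v| ^ 3 := by
  have h := Real.exp_bound hv (n := 3) (by norm_num)
  norm_num [Finset.sum_range_succ, Nat.factorial] at h
  refine h.trans ?_
  nlinarith [pow_nonneg (abs_nonneg v) 3]

section LogSumExp

variable {ι : Type*} [Fintype ι]

lemma abs_sum_mul_le_of_sum_eq_one {p w : ι → ℝ} (hp : ∀ i, 0 ≤ p i) (hp1 : ∑ i, p i = 1) {r : ℝ}
    (hw : ∀ i, |w i| ≤ r) : |∑ i, p i * w i| ≤ r := by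
  calc |∑ i, p i * w i| ≤ ∑ i, |p i * w i| := Finset.abs_sum_le_sum_abs _ _
    _ ≤ ∑ i, p i * r := Finset.sum_le_sum fun i _ => by
        rw [abs_mul, abs_of_nonneg (hp i)]
        exact mul_le_mul_of_nonneg_left (hw i) (hp i)
    _ = r := by rw [← Finset.sum_mul, hp1, one_mul]

/-- Third order error in the expansion of the cumulant generating function of a finitely supported
probability measure with weights `p`. -/
lemma abs_log_sum_mul_exp_sub_le {p v : ι → ℝ} (hp : ∀ i, 0 ≤ p i) (hp1 : ∑ i, p i = 1) {r : ℝ}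
    (hv : ∀ i, |v i| ≤ r) :
    |Real.log (∑ i, p i * Real.exp (v i)) -
      (∑ i, p i * v i + (∑ i, p i * v i ^ 2 - (∑ i, p i * v i) ^ 2) / 2)| ≤ 34 * r ^ 3 := by
  have hr : 0 ≤ r := by
    by_contra h
    have : IsEmpty ι := ⟨fun i => h ((abs_nonneg _).trans (hv i))⟩
    simp at hp1
  have h1 : |∑ i, p i * v i| ≤ r := abs_sum_mul_le_of_sum_eq_one hp hp1 hv
  have h2 : |∑ i, p i * v i ^ 2| ≤ r ^ 2 := abs_sum_mul_le_of_sum_eq_one hp hp1 fun i => by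
    rw [abs_pow]
    exact pow_le_pow_left₀ (abs_nonneg _) (hv i) 2
  have h2' : 0 ≤ ∑ i, p i * v i ^ 2 := Finset.sum_nonneg fun i _ => mul_nonneg (hp i) (sq_nonneg _)
  set m₁ := ∑ i, p i * v i
  set m₂ := ∑ i, p i * v i ^ 2
  rw [abs_of_nonneg h2'] at h2
  have hm1 : m₁ ^ 2 ≤ r ^ 2 := sq_le_sq' (abs_le.1 h1).1 (abs_le.1 h1).2
  -- Taylor expansion is used only for small r. For r ≥ 1/4 every term is bounded crudely: 2r + r²/2
  -- ≤ 32r³ + 2r³, which is the source of the constant 34.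
  rcases le_total r (1 / 4) with hr4 | hr4
  · have h3 : |∑ i, p i * (Real.exp (v i) - (1 + v i + v i ^ 2 / 2))| ≤ r ^ 3 :=
      abs_sum_mul_le_of_sum_eq_one hp hp1 fun i =>
        (abs_exp_sub_taylor_two_le ((hv i).trans (by linarith))).trans
          (pow_le_pow_left₀ (abs_nonneg _) (hv i) 3)
    set e := ∑ i, p i * (Real.exp (v i) - (1 + v i + v i ^ 2 / 2)) with he
    have hsum : ∑ i, p i * Real.exp (v i) = 1 + (m₁ + m₂ / 2 + e) := by
      calc ∑ i, p i * Real.exp (v i) = ∑ i, p i + (m₁ + m₂ / 2 + e) := by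
            rw [he, Finset.sum_div, ← Finset.sum_add_distrib, ← Finset.sum_add_distrib,
              ← Finset.sum_add_distrib]
            exact Finset.sum_congr rfl fun i _ => by ring
        _ = _ := by rw [hp1]
    rw [hsum]
    have hr2 : 0 ≤ r ^ 2 := sq_nonneg r
    have hr3 : r ^ 3 ≤ r ^ 2 / 4 := by nlinarith
    have hr2' : r ^ 2 ≤ r / 4 := by nlinarith
    obtain ⟨h1a, h1b⟩ := abs_le.1 h1
    obtain ⟨h3a, h3b⟩ := abs_le.1 h3
    set u := m₁ + m₂ / 2 + e with hu
    have hu2 : |u| ≤ 2 * r := abs_le.2 ⟨by linarith, by linarith⟩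
    have hd : |u - m₁| ≤ r ^ 2 := abs_le.2 ⟨by linarith, by linarith⟩
    have hs : |u + m₁| ≤ 3 * r := (abs_add_le _ _).trans (by linarith)
    have hlog := abs_log_one_add_sub_le (u := u) (by linarith)
    have hu3 : |u| ^ 3 ≤ (2 * r) ^ 3 := pow_le_pow_left₀ (abs_nonneg _) hu2 3
    have hprod : |(u - m₁) * (u + m₁)| ≤ r ^ 2 * (3 * r) := by
      rw [abs_mul]
      exact mul_le_mul hd hs (abs_nonneg _) hr2
    obtain ⟨ha, hb⟩ := abs_le.1 hlog
    obtain ⟨hc, hd'⟩ := abs_le.1 hprod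
    have h0 : 0 ≤ r ^ 3 := by positivity
    have e1 : u - u ^ 2 / 2 - (m₁ + (m₂ - m₁ ^ 2) / 2) = e - (u - m₁) * (u + m₁) / 2 := by
      rw [hu]; ring
    have e2 : r ^ 2 * (3 * r) = 3 * r ^ 3 := by ring
    have e3 : (2 * r) ^ 3 = 8 * r ^ 3 := by ring
    rw [abs_le]
    constructor <;> linarith
  · have hlo : Real.exp (-r) ≤ ∑ i, p i * Real.exp (v i) := by
      calc Real.exp (-r) = ∑ i, p i * Real.exp (-r) := by rw [← Finset.sum_mul, hp1, one_mul]
        _ ≤ _ := Finset.sum_le_sum fun i _ =>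
          mul_le_mul_of_nonneg_left (Real.exp_le_exp.2 (abs_le.1 (hv i)).1) (hp i)
    have hhi : ∑ i, p i * Real.exp (v i) ≤ Real.exp r := by
      calc _ ≤ ∑ i, p i * Real.exp r := Finset.sum_le_sum fun i _ =>
          mul_le_mul_of_nonneg_left (Real.exp_le_exp.2 (abs_le.1 (hv i)).2) (hp i)
        _ = Real.exp r := by rw [← Finset.sum_mul, hp1, one_mul]
    have hl1 := (Real.le_log_iff_exp_le ((Real.exp_pos _).trans_le hlo)).2 hlo
    have hl2 := (Real.log_le_iff_le_exp ((Real.exp_pos _).trans_le hlo)).2 hhi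
    obtain ⟨h1a, h1b⟩ := abs_le.1 h1
    have hr2 : r ≤ 16 * r ^ 3 := by nlinarith [mul_nonneg hr (show 0 ≤ 16 * r ^ 2 - 1 by nlinarith)]
    have hr3 : r ^ 2 ≤ 4 * r ^ 3 := by nlinarith [mul_nonneg (sq_nonneg r) (sub_nonneg.2 hr4)]
    have := sq_nonneg m₁
    rw [abs_le]
    constructor <;> linarith

/-- The quadratic form `Var_p(v)` in terms of the differences of the coordinates. -/
lemma sum_mul_sq_sub_sq_eq {p : ι → ℝ} (hp1 : ∑ i, p i = 1) (v : ι → ℝ) :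
    ∑ i, p i * v i ^ 2 - (∑ i, p i * v i) ^ 2 =
      (∑ i, ∑ j, p i * p j * (v i - v j) ^ 2) / 2 := by
  have h1 : ∑ i, ∑ j, p i * p j * (v i - v j) ^ 2 =
      ∑ i, ∑ j, (p i * v i ^ 2 * p j + p i * (p j * v j ^ 2) - 2 * (p i * v i) * (p j * v j)) :=
    Finset.sum_congr rfl fun i _ => Finset.sum_congr rfl fun j _ => by ring
  rw [h1]
  simp only [Finset.sum_sub_distrib, Finset.sum_add_distrib, ← Finset.mul_sum, ← Finset.sum_mul,
    hp1]
  ring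

/-- The function `x ↦ log ∑ i, exp (x i)`. -/
noncomputable def logSumExp (x : ι → ℝ) : ℝ := Real.log (∑ i, Real.exp (x i))

/-- The gradient of `logSumExp`. -/
noncomputable def softmax (x : ι → ℝ) (i : ι) : ℝ := Real.exp (x i) / ∑ j, Real.exp (x j)

variable [Nonempty ι]

lemma sum_exp_pos (x : ι → ℝ) : 0 < ∑ i, Real.exp (x i) :=
  Finset.sum_pos (fun _ _ => Real.exp_pos _) Finset.univ_nonempty

lemma softmax_nonneg (x : ι → ℝ) (i : ι) : 0 ≤ softmax x i :=
  div_nonneg (Real.exp_pos _).le (sum_exp_pos x).le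

lemma sum_softmax (x : ι → ℝ) : ∑ i, softmax x i = 1 := by
  simp only [softmax]
  rw [← Finset.sum_div, div_self (sum_exp_pos x).ne']

/-- The increment is the cumulant generating function of v under the softmax weights at x, so its
second-order term is half the variance of v under these weights. -/
lemma logSumExp_add (x v : ι → ℝ) :
    logSumExp (x + v) = logSumExp x + Real.log (∑ i, softmax x i * Real.exp (v i)) := by
  have h : ∑ i, softmax x i * Real.exp (v i) = (∑ i, Real.exp ((x + v) i)) / ∑ i, Real.exp (x i) := by
    rw [Finset.sum_div]
    exact Finset.sum_congr rfl fun i _ => by rw [softmax, Pi.add_apply, Real.exp_add]; ring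
  rw [h, Real.log_div (sum_exp_pos _).ne' (sum_exp_pos _).ne', logSumExp, logSumExp]
  ring

lemma logSumExp_mono {x y : ι → ℝ} (h : ∀ i, x i ≤ y i) : logSumExp x ≤ logSumExp y :=
  Real.log_le_log (sum_exp_pos x) (Finset.sum_le_sum fun i _ => Real.exp_le_exp.2 (h i))

lemma logSumExp_add_const (x : ι → ℝ) (c : ℝ) : logSumExp (fun i => x i + c) = logSumExp x + c := by
  simp only [logSumExp, Real.exp_add, ← Finset.sum_mul]
  rw [Real.log_mul (sum_exp_pos x).ne' (Real.exp_pos c).ne', Real.log_exp]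

lemma lipschitzWith_logSumExp : LipschitzWith 1 (logSumExp : (ι → ℝ) → ℝ) :=
  LipschitzWith.of_le_add fun x y => by
    rw [← logSumExp_add_const]
    exact logSumExp_mono fun i => by
      have := (le_abs_self _).trans ((Real.dist_eq _ _).symm.le.trans (dist_le_pi_dist x y i))
      linarith

lemma abs_logSumExp_add_sub_le (x v : ι → ℝ) :
    |logSumExp (x + v) - (logSumExp x + (∑ i, softmax x i * v i +
      (∑ i, softmax x i * v i ^ 2 - (∑ i, softmax x i * v i) ^ 2) / 2))| ≤ 34 * ‖v‖ ^ 3 := by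
  rw [logSumExp_add, add_sub_add_left_eq_sub]
  exact abs_log_sum_mul_exp_sub_le (softmax_nonneg x) (sum_softmax x) fun i => norm_le_pi_norm v i

lemma sup'_le_logSumExp (x : ι → ℝ) : Finset.univ.sup' Finset.univ_nonempty x ≤ logSumExp x :=
  Finset.sup'_le _ _ fun i _ => (Real.le_log_iff_exp_le (sum_exp_pos x)).2
    (Finset.single_le_sum (f := fun i => Real.exp (x i)) (fun _ _ => (Real.exp_pos _).le)
      (Finset.mem_univ i))

lemma logSumExp_le_sup'_add (x : ι → ℝ) :
    logSumExp x ≤ Finset.univ.sup' Finset.univ_nonempty x + Real.log (Fintype.card ι) := by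
  have h : ∀ i, x i ≤ Finset.univ.sup' Finset.univ_nonempty x :=
    fun i => Finset.le_sup' x (Finset.mem_univ i)
  generalize Finset.univ.sup' Finset.univ_nonempty x = M at h
  refine (logSumExp_mono (y := fun _ => M) h).trans_eq ?_
  rw [logSumExp, Finset.sum_const, nsmul_eq_mul, Real.log_mul _ (Real.exp_pos _).ne', Real.log_exp,
    add_comm, Finset.card_univ]
  exact Nat.cast_ne_zero.2 Fintype.card_ne_zero

end LogSumExp

/-! ### Lipschitz functions of Gaussian vectors and the Lindeberg exchange. -/

lemma LipschitzWith.integrable_of_integrable_norm {E : Type*} [NormedAddCommGroup E]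
    [MeasurableSpace E] [BorelSpace E] {μ : Measure E} [IsFiniteMeasure μ]
    (hμ : Integrable (fun x => ‖x‖) μ) {K : ℝ≥0} {f : E → ℝ} (hf : LipschitzWith K f) :
    Integrable f μ := by
  refine ((hμ.const_mul K).add (integrable_const |f 0|)).mono'
    hf.continuous.measurable.aestronglyMeasurable (ae_of_all _ fun x => ?_)
  have h := hf.dist_le_mul x 0
  rw [dist_zero_right, Real.dist_eq] at h
  have := abs_sub_abs_le_abs_sub (f x) (f 0)
  simp only [Real.norm_eq_abs, Pi.add_apply]
  linarith

lemma LipschitzWith.integral_param {E F : Type*} [NormedAddCommGroup E] [PseudoMetricSpace F]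
    [MeasurableSpace E] {μ : Measure E} [IsProbabilityMeasure μ] {K : ℝ≥0} {f : F → E → ℝ}
    (hf : ∀ y, LipschitzWith K (fun x => f x y)) (hint : ∀ x, Integrable (f x) μ) :
    LipschitzWith K (fun x => ∫ y, f x y ∂μ) := by
  refine LipschitzWith.of_dist_le_mul fun x x' => ?_
  rw [dist_eq_norm, ← integral_sub (hint x) (hint x')]
  refine (norm_integral_le_of_norm_le_const (C := K * dist x x') (ae_of_all _ fun y => ?_)).trans_eq
    (by simp)
  rw [← dist_eq_norm]
  exact (hf y).dist_le_mul x x'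

lemma lipschitzWith_add_smul {E : Type*} [NormedAddCommGroup E] [NormedSpace ℝ E]
    {K : ℝ≥0} {f : E → ℝ} (hf : LipschitzWith K f) (z : E) (a : ℝ) :
    LipschitzWith (K * ‖a‖₊) (fun x => f (z + a • x)) :=
  hf.comp (by simpa using (LipschitzWith.const z).add (lipschitzWith_smul a))

section Gaussian

variable {E : Type*} [NormedAddCommGroup E] [NormedSpace ℝ E] [CompleteSpace E]
  [SecondCountableTopology E] [MeasurableSpace E] [BorelSpace E]

lemma ProbabilityTheory.IsGaussian.integrable_norm_pow (μ : Measure E) [IsGaussian μ] (n : ℕ) :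
    Integrable (fun x => ‖x‖ ^ n) μ :=
  (IsGaussian.memLp_id μ n (by simp)).integrable_norm_pow'

lemma ProbabilityTheory.IsGaussian.integrable_norm (μ : Measure E) [IsGaussian μ] :
    Integrable (fun x => ‖x‖) μ := by
  simpa using IsGaussian.integrable_norm_pow μ 1

lemma LipschitzWith.integrable_prod_add_smul {μ ν : Measure E} [IsGaussian μ] [IsGaussian ν]
    {K : ℝ≥0} {f : E → ℝ} (hf : LipschitzWith K f) (z : E) (a b : ℝ) :
    Integrable (fun p : E × E => f (z + a • p.1 + b • p.2)) (μ.prod ν) := by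
  have hn : Integrable (fun p : E × E => ‖p‖) (μ.prod ν) := by
    refine (((IsGaussian.integrable_norm μ).comp_fst ν).add
      ((IsGaussian.integrable_norm ν).comp_snd μ)).mono' (by fun_prop) (ae_of_all _ fun p => ?_)
    rw [norm_norm, Prod.norm_def]
    exact max_le_add_of_nonneg (norm_nonneg _) (norm_nonneg _)
  have hl : LipschitzWith (0 + ‖a‖₊ * 1 + ‖b‖₊ * 1) (fun p : E × E => z + a • p.1 + b • p.2) :=
    ((LipschitzWith.const z).add ((lipschitzWith_smul a).comp LipschitzWith.prod_fst)).add
      ((lipschitzWith_smul b).comp LipschitzWith.prod_snd)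
  exact (hf.comp hl).integrable_of_integrable_norm hn

/-- A centered Gaussian measure is stable: if `X, X'` are independent with law `μ`, then
`a X + h X'` has the law of `√(a² + h²) X`. -/
lemma ProbabilityTheory.IsGaussian.integral_comp_sqrt_smul {μ : Measure E} [IsGaussian μ]
    (hμ : ∫ x, id x ∂μ = 0) {K : ℝ≥0} {f : E → ℝ} (hf : LipschitzWith K f) (a h : ℝ) (z : E) :
    ∫ x, f (z + √(a ^ 2 + h ^ 2) • x) ∂μ = ∫ x, ∫ y, f (z + a • x + h • y) ∂μ ∂μ := by
  -- The polar angle of (a, h): rotating an independent pair (x, y) by θ leaves its law unchanged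
  -- and turns √(a²+h²) x into a x + h y.
  set θ := Complex.arg ⟨a, h⟩
  have hr : ‖(⟨a, h⟩ : ℂ)‖ = √(a ^ 2 + h ^ 2) := by
    rw [Complex.norm_def, Complex.normSq_mk, sq, sq]
  have ha : √(a ^ 2 + h ^ 2) * Real.cos θ = a := by rw [← hr]; exact Complex.norm_mul_cos_arg _
  have hh : √(a ^ 2 + h ^ 2) * Real.sin θ = h := by rw [← hr]; exact Complex.norm_mul_sin_arg _
  have hint := hf.integrable_prod_add_smul (μ := μ) (ν := μ) z a h
  calc ∫ x, f (z + √(a ^ 2 + h ^ 2) • x) ∂μ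
      = ∫ p, f (z + √(a ^ 2 + h ^ 2) • p.1) ∂(μ.prod μ) := by
        rw [integral_fun_fst (fun x => f (z + √(a ^ 2 + h ^ 2) • x))]; simp
    _ = ∫ p, f (z + √(a ^ 2 + h ^ 2) • p.1) ∂((μ.prod μ).map (ContinuousLinearMap.rotation θ)) := by
        rw [IsGaussian.map_rotation_eq_self hμ]
    _ = ∫ p, f (z + a • p.1 + h • p.2) ∂(μ.prod μ) := by
        refine (integral_map (by fun_prop)
          (hf.continuous.comp (by fun_prop)).aestronglyMeasurable).trans ?_
        simp only [Function.comp_apply, ContinuousLinearMap.rotation_apply, smul_add, smul_smul, ha, hh, add_assoc]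
    _ = _ := integral_prod _ hint

/-- Swapping the noise in one of two independent Gaussian components. -/
lemma integral_integral_comp_sqrt_smul_le {μ ν : Measure E} [IsGaussian μ] [IsGaussian ν]
    (hμ : ∫ x, id x ∂μ = 0) (hν : ∫ x, id x ∂ν = 0) {K : ℝ≥0} {f : E → ℝ} (hf : LipschitzWith K f)
    {h ε : ℝ} (hfh : ∀ z, ∫ x, f (z + h • x) ∂μ ≤ ∫ x, f (z + h • x) ∂ν + ε) (a b : ℝ) (m : E) :
    ∫ y, ∫ x, f (m + b • y + √(a ^ 2 + h ^ 2) • x) ∂μ ∂ν ≤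
      ∫ y, ∫ x, f (m + √(b ^ 2 + h ^ 2) • y + a • x) ∂μ ∂ν + ε := by
  have hnμ := IsGaussian.integrable_norm μ
  have hnν := IsGaussian.integrable_norm ν
  have hLμ : ∀ z c, Integrable (fun x => f (z + c • x)) μ := fun z c =>
    (lipschitzWith_add_smul hf z c).integrable_of_integrable_norm hnμ
  have hLν : ∀ z c, Integrable (fun x => f (z + c • x)) ν := fun z c =>
    (lipschitzWith_add_smul hf z c).integrable_of_integrable_norm hnν
  have hshift : ∀ (y : E) (c : ℝ), LipschitzWith K (fun z : E => f (z + c • y)) := fun y c => by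
    have := hf.comp (LipschitzWith.id.add (LipschitzWith.const (c • y)))
    rwa [add_zero, mul_one] at this
  have hAμ : ∀ c, LipschitzWith K (fun z => ∫ x, f (z + c • x) ∂μ) := fun c =>
    LipschitzWith.integral_param (fun y => hshift y c) (fun z => hLμ z c)
  have hAν : ∀ c, LipschitzWith K (fun z => ∫ x, f (z + c • x) ∂ν) := fun c =>
    LipschitzWith.integral_param (fun y => hshift y c) (fun z => hLν z c)
  have hint : ∀ {g : E → ℝ} {L : ℝ≥0}, LipschitzWith L g →
      Integrable (Function.uncurry fun y x : E => g (m + b • y + a • x)) (ν.prod μ) := by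
    intro g L hg
    exact hg.integrable_prod_add_smul m b a
  -- Stability splits an increment of size h off the `μ`-noise here and off the `ν`-noise in `e2`.
  -- The two sides then differ only in the law of that last increment, where `hfh` applies
  -- pointwise.
  have e1 : ∫ y, ∫ x, f (m + b • y + √(a ^ 2 + h ^ 2) • x) ∂μ ∂ν =
      ∫ y, ∫ x, ∫ x', f (m + b • y + a • x + h • x') ∂μ ∂μ ∂ν :=
    integral_congr_ae (ae_of_all _ fun y => IsGaussian.integral_comp_sqrt_smul hμ hf a h _)
  have e2 : ∫ y, ∫ x, f (m + √(b ^ 2 + h ^ 2) • y + a • x) ∂μ ∂ν =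
      ∫ y, ∫ x, ∫ y', f (m + b • y + a • x + h • y') ∂ν ∂μ ∂ν := by
    rw [IsGaussian.integral_comp_sqrt_smul hν (hAμ a) b h m]
    refine integral_congr_ae (ae_of_all _ fun y => ?_)
    have hsw := integral_integral_swap (μ := ν) (ν := μ)
      (f := fun y' x => f (m + b • y + h • y' + a • x)) ?_
    · simp only at hsw ⊢
      rw [hsw]
      simp only [add_right_comm]
    · exact hf.integrable_prod_add_smul (m + b • y) h a
  rw [e1, e2]
  have hεint : Integrable (fun p : E × E => (∫ y', f (m + b • p.1 + a • p.2 + h • y') ∂ν) + ε)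
      (ν.prod μ) := (hint (hAν h)).add (integrable_const ε)
  have i1 := integral_integral (hint (hAμ h))
  have i2 := integral_integral (hint (hAν h))
  rw [i1, i2]
  calc _ ≤ ∫ p : E × E, ((∫ y', f (m + b • p.1 + a • p.2 + h • y') ∂ν) + ε) ∂(ν.prod μ) :=
        integral_mono (hint (hAμ h)) hεint fun p => hfh _
    _ = _ := by
        have := integral_add (hint (hAν h)) (integrable_const (μ := ν.prod μ) ε)
        simp only [Function.uncurry] at this
        rw [this]; simp

/-- A Lindeberg type comparison: if replacing a small Gaussian perturbation with law `μ` by one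
with law `ν` decreases the expectation of `f` by at most a third order term, the inequality holds
for perturbations of any size. -/
lemma integral_comp_smul_le_of_small {μ ν : Measure E} [IsGaussian μ] [IsGaussian ν]
    (hμ : ∫ x, id x ∂μ = 0) (hν : ∫ x, id x ∂ν = 0) {K : ℝ≥0} {f : E → ℝ} (hf : LipschitzWith K f)
    {C : ℝ} (hfC : ∀ h, 0 ≤ h → ∀ z, ∫ x, f (z + h • x) ∂μ ≤ ∫ x, f (z + h • x) ∂ν + C * h ^ 3)
    {β : ℝ} (hβ : 0 ≤ β) (m : E) :
    ∫ x, f (m + β • x) ∂μ ≤ ∫ x, f (m + β • x) ∂ν := by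
  -- Here k increments already have law `ν` and n still have law `μ`; each exchange costs C h³.
  have step : ∀ h, 0 ≤ h → ∀ n k : ℕ,
      ∫ y, ∫ x, f (m + √(k * h ^ 2) • y + √(n * h ^ 2) • x) ∂μ ∂ν ≤
        ∫ x, f (m + √((n + k : ℕ) * h ^ 2) • x) ∂ν + n * (C * h ^ 3) := by
    intro h hh n
    induction n with
    | zero => intro k; simp
    | succ n ih =>
      intro k
      have h1 := integral_integral_comp_sqrt_smul_le hμ hν hf (hfC h hh) (√(n * h ^ 2))
        (√(k * h ^ 2)) m
      rw [Real.sq_sqrt (by positivity), Real.sq_sqrt (by positivity)] at h1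
      have h2 := ih (k + 1)
      push_cast at h2 ⊢
      simp only [add_mul, one_mul, add_assoc, add_comm, add_left_comm] at h1 h2 ⊢
      linarith
  have main : ∀ n : ℕ, ∫ x, f (m + β • x) ∂μ - ∫ x, f (m + β • x) ∂ν ≤
      C * β ^ 3 * (√((n : ℝ) + 1))⁻¹ := by
    intro n
    have hn : (0 : ℝ) < n + 1 := by positivity
    -- With n + 1 increments of size β/√(n+1) the total variance factor is β², and the accumulated
    -- error is C β³/√(n+1).
    have h1 := step (β / √(n + 1)) (by positivity) (n + 1) 0
    have e : ((n + 1 : ℕ) : ℝ) * (β / √((n : ℝ) + 1)) ^ 2 = β ^ 2 := by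
      rw [div_pow, Real.sq_sqrt hn.le]; push_cast; field_simp
    have e3 : ((n + 1 : ℕ) : ℝ) * (C * (β / √((n : ℝ) + 1)) ^ 3) = C * β ^ 3 * (√((n : ℝ) + 1))⁻¹ := by
      rw [div_pow, pow_succ (√((n : ℝ) + 1)) 2, Real.sq_sqrt hn.le]; push_cast; field_simp
    rw [add_zero, e3, e, Real.sqrt_sq hβ] at h1
    simp at h1
    linarith
  have lim : Filter.Tendsto (fun n : ℕ => C * β ^ 3 * (√((n : ℝ) + 1))⁻¹) Filter.atTop (nhds 0) := by
    rw [← mul_zero (C * β ^ 3)]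
    refine Filter.Tendsto.const_mul _ (Filter.Tendsto.inv_tendsto_atTop ?_)
    exact Real.tendsto_sqrt_atTop.comp
      (Filter.tendsto_atTop_add_const_right _ _ tendsto_natCast_atTop_atTop)
  linarith [ge_of_tendsto' lim main]

end Gaussian

/-! ### The Sudakov–Fernique inequality in finite dimension. -/

section FiniteComparison

variable {ι : Type*} [Fintype ι]

lemma ProbabilityTheory.IsGaussian.memLp_eval (μ : Measure (ι → ℝ)) [IsGaussian μ] (i : ι) :
    MemLp (fun x : ι → ℝ => x i) 2 μ :=
  (ContinuousLinearMap.proj (R := ℝ) (φ := fun _ : ι => ℝ) i).comp_memLp'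
    (IsGaussian.memLp_id μ 2 (by simp))

lemma ProbabilityTheory.IsGaussian.integrable_eval (μ : Measure (ι → ℝ)) [IsGaussian μ] (i : ι) :
    Integrable (fun x : ι → ℝ => x i) μ :=
  (IsGaussian.memLp_eval μ i).integrable (by norm_num)

lemma ProbabilityTheory.IsGaussian.integrable_sub_eval_sq (μ : Measure (ι → ℝ)) [IsGaussian μ]
    (i j : ι) : Integrable (fun x : ι → ℝ => (x i - x j) ^ 2) μ :=
  ((IsGaussian.memLp_eval μ i).sub (IsGaussian.memLp_eval μ j)).integrable_sq

variable [Nonempty ι]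

/-- The linear term integrates to zero by centering. The quadratic term is half of a variance,
itself half of a double sum over differences, whence h²/4; the remainder is the cubic error
integrated against the finite third moment. -/
lemma abs_integral_logSumExp_sub_le {μ : Measure (ι → ℝ)} [IsGaussian μ]
    (hμ : ∀ i, ∫ x, x i ∂μ = 0) {h : ℝ} (hh : 0 ≤ h) (z : ι → ℝ) :
    |∫ x, logSumExp (z + h • x) ∂μ - (logSumExp z +
      h ^ 2 / 4 * ∑ i, ∑ j, softmax z i * softmax z j * ∫ x, (x i - x j) ^ 2 ∂μ)| ≤
      34 * (∫ x, ‖x‖ ^ 3 ∂μ) * h ^ 3 := by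
  have hlse : Integrable (fun x => logSumExp (z + h • x)) μ :=
    (lipschitzWith_add_smul lipschitzWith_logSumExp z h).integrable_of_integrable_norm
      (IsGaussian.integrable_norm μ)
  set p := softmax z
  have i1 : Integrable (fun x : ι → ℝ => h * ∑ i, p i * x i) μ :=
    (integrable_finsetSum _ fun i _ => (IsGaussian.integrable_eval μ i).const_mul _).const_mul _
  have i2' : ∀ i j, Integrable (fun x : ι → ℝ => p i * p j * (x i - x j) ^ 2) μ := fun i j =>
    (IsGaussian.integrable_sub_eval_sq μ i j).const_mul _
  have i2 : Integrable (fun x : ι → ℝ => h ^ 2 / 4 * ∑ i, ∑ j, p i * p j * (x i - x j) ^ 2) μ :=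
    (integrable_finsetSum _ fun i _ => integrable_finsetSum _ fun j _ => i2' i j).const_mul _
  have i3 : Integrable (fun x : ι → ℝ => h * ∑ i, p i * x i +
      h ^ 2 / 4 * ∑ i, ∑ j, p i * p j * (x i - x j) ^ 2) μ := i1.add i2
  have i4 : Integrable (fun x : ι → ℝ => logSumExp z + (h * ∑ i, p i * x i +
      h ^ 2 / 4 * ∑ i, ∑ j, p i * p j * (x i - x j) ^ 2)) μ := (integrable_const _).add i3
  have hG : ∫ x : ι → ℝ, (logSumExp z + (h * ∑ i, p i * x i +
      h ^ 2 / 4 * ∑ i, ∑ j, p i * p j * (x i - x j) ^ 2)) ∂μ = logSumExp z +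
      h ^ 2 / 4 * ∑ i, ∑ j, p i * p j * ∫ x, (x i - x j) ^ 2 ∂μ := by
    rw [integral_add (integrable_const _) i3, integral_add i1 i2, integral_const_mul,
      integral_const_mul, integral_finsetSum _ fun i _ =>
        (IsGaussian.integrable_eval μ i).const_mul _,
      integral_finsetSum _ fun i _ => integrable_finsetSum _ fun j _ => i2' i j]
    simp_rw [integral_const_mul, hμ]
    simp only [integral_const, probReal_univ, one_smul, mul_zero, Finset.sum_const_zero, zero_add]
    congr 2
    refine Finset.sum_congr rfl fun i _ => ?_
    rw [integral_finsetSum _ fun j _ => i2' i j]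
    simp_rw [integral_const_mul]
  rw [← hG, ← integral_sub hlse i4]
  have hb : Integrable (fun x : ι → ℝ => 34 * h ^ 3 * ‖x‖ ^ 3) μ :=
    (IsGaussian.integrable_norm_pow μ 3).const_mul _
  rw [← Real.norm_eq_abs, show 34 * (∫ x, ‖x‖ ^ 3 ∂μ) * h ^ 3 = ∫ x, 34 * h ^ 3 * ‖x‖ ^ 3 ∂μ by
    rw [integral_const_mul]; ring]
  refine norm_integral_le_of_norm_le hb (ae_of_all _ fun x => ?_)
  have key := abs_logSumExp_add_sub_le z (h • x)
  rw [sum_mul_sq_sub_sq_eq (sum_softmax z), norm_smul, Real.norm_of_nonneg hh] at key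
  have e1 : ∑ i, softmax z i * (h • x) i = h * ∑ i, p i * x i := by
    rw [Finset.mul_sum]
    exact Finset.sum_congr rfl fun i _ => by rw [Pi.smul_apply, smul_eq_mul]; ring
  have e2 : (∑ i, ∑ j, softmax z i * softmax z j * ((h • x) i - (h • x) j) ^ 2) / 2 / 2 =
      h ^ 2 / 4 * ∑ i, ∑ j, p i * p j * (x i - x j) ^ 2 := by
    have : ∑ i, ∑ j, softmax z i * softmax z j * ((h • x) i - (h • x) j) ^ 2 =
        h ^ 2 * ∑ i, ∑ j, p i * p j * (x i - x j) ^ 2 := by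
      simp_rw [Finset.mul_sum]
      exact Finset.sum_congr rfl fun i _ => Finset.sum_congr rfl fun j _ => by
        simp only [Pi.smul_apply, smul_eq_mul]; ring
    rw [this]; ring
  rw [e1, e2] at key
  exact key.trans_eq (by ring)

/-- The softmax weights are nonnegative, so ordered increments order the h² terms; the two cubic
remainders add up to the error allowed in the Lindeberg exchange. -/
lemma integral_logSumExp_le {μ ν : Measure (ι → ℝ)} [IsGaussian μ] [IsGaussian ν]
    (hμ : ∀ i, ∫ x, x i ∂μ = 0) (hν : ∀ i, ∫ x, x i ∂ν = 0)
    (hμν : ∀ i j, ∫ x, (x i - x j) ^ 2 ∂μ ≤ ∫ x, (x i - x j) ^ 2 ∂ν) {β : ℝ} (hβ : 0 ≤ β)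
    (m : ι → ℝ) : ∫ x, logSumExp (m + β • x) ∂μ ≤ ∫ x, logSumExp (m + β • x) ∂ν := by
  have hid : ∀ (ρ : Measure (ι → ℝ)) [IsGaussian ρ], (∀ i, ∫ x, x i ∂ρ = 0) →
      ∫ x, id x ∂ρ = 0 := fun ρ _ hρ => by
    ext i
    simp only [id]
    rw [eval_integral fun i => IsGaussian.integrable_eval ρ i]
    exact hρ i
  refine integral_comp_smul_le_of_small (hid μ hμ) (hid ν hν) lipschitzWith_logSumExp
    (C := 34 * ∫ x, ‖x‖ ^ 3 ∂μ + 34 * ∫ x, ‖x‖ ^ 3 ∂ν) (fun h hh z => ?_) hβ m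
  have h1 := (abs_le.1 (abs_integral_logSumExp_sub_le hμ hh z)).2
  have h2 := (abs_le.1 (abs_integral_logSumExp_sub_le hν hh z)).1
  have h3 : h ^ 2 / 4 * ∑ i, ∑ j, softmax z i * softmax z j * ∫ x, (x i - x j) ^ 2 ∂μ ≤
      h ^ 2 / 4 * ∑ i, ∑ j, softmax z i * softmax z j * ∫ x, (x i - x j) ^ 2 ∂ν := by
    refine mul_le_mul_of_nonneg_left (Finset.sum_le_sum fun i _ => Finset.sum_le_sum fun j _ => ?_)
      (by positivity)
    exact mul_le_mul_of_nonneg_left (hμν i j)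
      (mul_nonneg (softmax_nonneg z i) (softmax_nonneg z j))
  linarith

lemma lipschitzWith_sup'_univ :
    LipschitzWith 1 (fun x : ι → ℝ => Finset.univ.sup' Finset.univ_nonempty x) :=
  LipschitzWith.of_le_add fun x y => Finset.sup'_le _ _ fun i _ => by
    have h1 := Finset.le_sup' y (Finset.mem_univ i)
    have h2 := (le_abs_self _).trans ((Real.dist_eq _ _).symm.le.trans (dist_le_pi_dist x y i))
    linarith

/-- The **Sudakov–Fernique inequality** for finitely many shifted Gaussian variables. -/
theorem integral_sup'_le_of_increments_le {μ ν : Measure (ι → ℝ)} [IsGaussian μ] [IsGaussian ν]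
    (hμ : ∀ i, ∫ x, x i ∂μ = 0) (hν : ∀ i, ∫ x, x i ∂ν = 0)
    (hμν : ∀ i j, ∫ x, (x i - x j) ^ 2 ∂μ ≤ ∫ x, (x i - x j) ^ 2 ∂ν) (m : ι → ℝ) :
    ∫ x, Finset.univ.sup' Finset.univ_nonempty (m + x) ∂μ ≤
      ∫ x, Finset.univ.sup' Finset.univ_nonempty (m + x) ∂ν := by
  have hsup : ∀ (ρ : Measure (ι → ℝ)) [IsGaussian ρ],
      Integrable (fun x => Finset.univ.sup' Finset.univ_nonempty (m + x)) ρ := fun ρ _ => by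
    have h := (lipschitzWith_add_smul lipschitzWith_sup'_univ m 1).integrable_of_integrable_norm
      (IsGaussian.integrable_norm ρ)
    simpa only [one_smul] using h
  have hlse : ∀ (ρ : Measure (ι → ℝ)) [IsGaussian ρ] (z : ι → ℝ) (β : ℝ),
      Integrable (fun x => logSumExp (z + β • x)) ρ := fun ρ _ z β =>
    (lipschitzWith_add_smul lipschitzWith_logSumExp z β).integrable_of_integrable_norm
      (IsGaussian.integrable_norm ρ)
  have hscale : ∀ (β : ℝ), 0 ≤ β → ∀ x : ι → ℝ,
      Finset.univ.sup' Finset.univ_nonempty (β • m + β • x) =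
        β * Finset.univ.sup' Finset.univ_nonempty (m + x) := fun β hβ x => by
    rw [Finset.mul₀_sup' hβ]
    exact Finset.sup'_congr _ rfl fun i _ => by simp [mul_add]
  -- At inverse temperature n + 1, log-sum-exp exceeds the scaled maximum by at most the logarithm
  -- of the number of coordinates; dividing by n + 1 makes this negligible.
  have key : ∀ n : ℕ, ∫ x, Finset.univ.sup' Finset.univ_nonempty (m + x) ∂μ -
      ∫ x, Finset.univ.sup' Finset.univ_nonempty (m + x) ∂ν ≤
      Real.log (Fintype.card ι) * ((n : ℝ) + 1)⁻¹ := by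
    intro n
    have hβ : (0 : ℝ) < n + 1 := by positivity
    have h1 : ((n : ℝ) + 1) * ∫ x, Finset.univ.sup' Finset.univ_nonempty (m + x) ∂μ ≤
        ∫ x, logSumExp (((n : ℝ) + 1) • m + ((n : ℝ) + 1) • x) ∂μ := by
      rw [← integral_const_mul]
      refine integral_mono ((hsup μ).const_mul _) (hlse μ _ _) fun x => ?_
      simp only
      rw [← hscale _ hβ.le]
      exact sup'_le_logSumExp _
    have h2 := integral_logSumExp_le hμ hν hμν hβ.le (((n : ℝ) + 1) • m)
    have h3 : ∫ x, logSumExp (((n : ℝ) + 1) • m + ((n : ℝ) + 1) • x) ∂ν ≤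
        ((n : ℝ) + 1) * ∫ x, Finset.univ.sup' Finset.univ_nonempty (m + x) ∂ν +
          Real.log (Fintype.card ι) := by
      have e : ((n : ℝ) + 1) * ∫ x, Finset.univ.sup' Finset.univ_nonempty (m + x) ∂ν +
          Real.log (Fintype.card ι) = ∫ x, (((n : ℝ) + 1) *
            Finset.univ.sup' Finset.univ_nonempty (m + x) + Real.log (Fintype.card ι)) ∂ν := by
        rw [integral_add ((hsup ν).const_mul _) (integrable_const _), integral_const_mul]
        simp
      rw [e]
      refine integral_mono (hlse ν _ _) (((hsup ν).const_mul _).add (integrable_const _)) fun x => ?_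
      simp only
      rw [← hscale _ hβ.le]
      exact logSumExp_le_sup'_add _
    rw [← div_eq_mul_inv, le_div_iff₀ hβ]
    linarith
  have lim : Filter.Tendsto (fun n : ℕ => Real.log (Fintype.card ι) * ((n : ℝ) + 1)⁻¹) Filter.atTop
      (nhds 0) := by
    rw [← mul_zero (Real.log (Fintype.card ι))]
    exact (Filter.Tendsto.inv_tendsto_atTop
      (Filter.tendsto_atTop_add_const_right _ _ tendsto_natCast_atTop_atTop)).const_mul _
  linarith [ge_of_tendsto' lim key]

end FiniteComparison

/-! ### From truncated expectations to the increasing convex order. -/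

section IncreasingConvexOrder

lemma ConvexOn.exists_subgradient {g : ℝ → ℝ} (hg : ConvexOn ℝ Set.univ g) :
    ∃ s : ℝ → ℝ, ∀ q y, g q + s q * (y - q) ≤ g y := by
  refine ⟨fun q => derivWithin g (Set.Ioi q) q, fun q y => ?_⟩
  have hmem : ∀ x : ℝ, x ∈ interior (Set.univ : Set ℝ) := fun x => by simp
  rcases lt_trichotomy q y with h | rfl | h
  · have := hg.rightDeriv_le_slope_of_mem_interior (hmem q) (Set.mem_univ y) h
    rw [slope_def_field, le_div_iff₀ (by linarith)] at this
    linarith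
  · simp
  · have h1 := hg.slope_le_leftDeriv_of_mem_interior (Set.mem_univ y) (hmem q) h
    have h2 := h1.trans (hg.leftDeriv_le_rightDeriv_of_mem_interior (hmem q))
    rw [slope_def_field, div_le_iff₀ (by linarith)] at h2
    linarith

section Tangents

variable {g s : ℝ → ℝ}

lemma monotone_of_subgradient (hs : ∀ q y, g q + s q * (y - q) ≤ g y) : Monotone s := by
  intro a b hab
  rcases hab.eq_or_lt with rfl | hab
  · exact le_rfl
  have h1 := hs a b
  have h2 := hs b a
  exact le_of_mul_le_mul_right (by linarith : s a * (b - a) ≤ s b * (b - a)) (by linarith)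

lemma subgradient_nonneg (hs : ∀ q y, g q + s q * (y - q) ≤ g y) (hg : Monotone g) (q : ℝ) :
    0 ≤ s q := by
  have h1 := hs q (q - 1)
  have h2 := hg (show q - 1 ≤ q by linarith)
  linarith

/-- The value at `x` of the upper envelope of the tangents with slopes `s` to the graph of `g` at
the points `a, a + h, …, a + n h`, written as a combination of functions `x ↦ (A + B x)⁺`. -/
noncomputable def tangentEnvelope (g s : ℝ → ℝ) (a h : ℝ) (n : ℕ) (x : ℝ) : ℝ :=
  g a + s a * (x - a) + ∑ k ∈ Finset.range n,
    max (g (a + (k + 1 : ℕ) * h) + s (a + (k + 1 : ℕ) * h) * (x - (a + (k + 1 : ℕ) * h)) -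
      (g (a + k * h) + s (a + k * h) * (x - (a + k * h)))) 0

lemma tangent_le_tangentEnvelope (g s : ℝ → ℝ) (a h : ℝ) {n k : ℕ} (hk : k ≤ n) (x : ℝ) :
    g (a + k * h) + s (a + k * h) * (x - (a + k * h)) ≤ tangentEnvelope g s a h n x := by
  induction n, hk using Nat.le_induction with
  | base =>
    induction k with
    | zero => simp [tangentEnvelope]
    | succ k ih =>
      rw [tangentEnvelope, Finset.sum_range_succ, ← add_assoc, ← tangentEnvelope]
      refine le_trans ?_ (add_le_add ih (le_max_left _ _))
      linarith
  | succ n _ ih =>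
    rw [tangentEnvelope, Finset.sum_range_succ, ← add_assoc, ← tangentEnvelope]
    exact ih.trans (le_add_of_nonneg_right (le_max_right _ _))

/-- The induction also carries that, to the right of the last node, the envelope is the last
tangent. Left of that node the next positive part vanishes; right of it, adding the positive part
takes the maximum of the last tangent and the new one, both below g. -/
lemma tangentEnvelope_le (hs : ∀ q y, g q + s q * (y - q) ≤ g y) (a : ℝ) {h : ℝ} (hh : 0 ≤ h)
    (n : ℕ) (x : ℝ) : tangentEnvelope g s a h n x ≤ g x := by
  have hmono := monotone_of_subgradient hs
  suffices tangentEnvelope g s a h n x ≤ g x ∧ (a + n * h ≤ x →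
      tangentEnvelope g s a h n x = g (a + n * h) + s (a + n * h) * (x - (a + n * h))) from this.1
  induction n with
  | zero => simp [tangentEnvelope, hs]
  | succ n ih =>
    obtain ⟨ih1, ih2⟩ := ih
    rw [tangentEnvelope, Finset.sum_range_succ, ← add_assoc, ← tangentEnvelope]
    set q := a + n * h
    set q' := a + (n + 1 : ℕ) * h with hq'
    have hqq' : q ≤ q' := by rw [hq']; push_cast; linarith
    have hsq := hmono hqq'
    have t1 := hs q q'
    have t2 := hs q' q
    rcases le_total x q with hx | hx
    · have hz : g q' + s q' * (x - q') - (g q + s q * (x - q)) ≤ 0 := by nlinarith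
      rw [max_eq_right hz, add_zero]
      refine ⟨ih1, fun hx' => ?_⟩
      have hxq : x = q := le_antisymm hx (hqq'.trans hx')
      have hq'x : q' = q := le_antisymm (hx'.trans hx) hqq'
      rw [ih2 hxq.ge, hq'x]
    · rw [ih2 hx]
      refine ⟨?_, fun hx' => ?_⟩
      · rw [← max_add_add_left, add_zero, add_sub_cancel]
        exact max_le (hs q' x) (hs q x)
      · have hz : 0 ≤ g q' + s q' * (x - q') - (g q + s q * (x - q)) := by nlinarith
        rw [max_eq_left hz, add_sub_cancel]

/-- Some node lies at most h to the left of x. Its tangent has nonnegative slope, so at x it is at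
least the value of g at the node, hence at least g(x - h). -/
lemma le_tangentEnvelope (hs : ∀ q y, g q + s q * (y - q) ≤ g y) (hg : Monotone g) {a h : ℝ}
    (hh : 0 < h) {n : ℕ} {x : ℝ} (hax : a ≤ x) (hxn : x ≤ a + n * h) :
    g (x - h) ≤ tangentEnvelope g s a h n x := by
  have h0 : 0 ≤ (x - a) / h := div_nonneg (by linarith) hh.le
  have hk1 : (⌊(x - a) / h⌋₊ : ℝ) * h ≤ x - a := (le_div_iff₀ hh).1 (Nat.floor_le h0)
  have hk2 : x - a < ((⌊(x - a) / h⌋₊ : ℝ) + 1) * h := (div_lt_iff₀ hh).1 (Nat.lt_floor_add_one _)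
  have hkn : ⌊(x - a) / h⌋₊ ≤ n := Nat.floor_le_of_le ((div_le_iff₀ hh).2 (by linarith))
  refine le_trans ?_ (tangent_le_tangentEnvelope g s a h hkn x)
  have h1 : g (x - h) ≤ g (a + ⌊(x - a) / h⌋₊ * h) := hg (by linarith)
  have h2 := mul_nonneg (subgradient_nonneg hs hg (a + ⌊(x - a) / h⌋₊ * h))
    (show 0 ≤ x - (a + ⌊(x - a) / h⌋₊ * h) by linarith)
  linarith

/-- The nodes run from -j to j with mesh 1/(j+1), which takes 2j(j+1) steps, so x is eventually
covered at vanishing mesh. -/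
lemma tendsto_tangentEnvelope (hs : ∀ q y, g q + s q * (y - q) ≤ g y) (hg : Monotone g)
    (hc : Continuous g) (x : ℝ) :
    Filter.Tendsto (fun j : ℕ => tangentEnvelope g s (-j) (1 / ((j : ℝ) + 1)) (2 * (j * (j + 1))) x)
      Filter.atTop (nhds (g x)) := by
  have hlo : Filter.Tendsto (fun j : ℕ => g (x - 1 / ((j : ℝ) + 1))) Filter.atTop (nhds (g x)) := by
    have := (hc.tendsto (x - 0)).comp
      (tendsto_const_nhds.sub (tendsto_one_div_add_atTop_nhds_zero_nat (𝕜 := ℝ)))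
    rw [sub_zero] at this
    exact this
  refine tendsto_of_tendsto_of_tendsto_of_le_of_le' hlo tendsto_const_nhds ?_
    (Filter.Eventually.of_forall fun j => tangentEnvelope_le hs _ (by positivity) _ x)
  filter_upwards [Filter.eventually_ge_atTop ⌈|x|⌉₊] with j hj
  have hj' := abs_le.1 (Nat.ceil_le.1 hj)
  refine le_tangentEnvelope hs hg (by positivity) hj'.1 ?_
  push_cast
  field_simp
  linarith

end Tangents

variable {Ω Ω' : Type*} [MeasurableSpace Ω] [MeasurableSpace Ω'] {P : Measure Ω}
  {P' : Measure Ω'} {X : Ω → ℝ} {Y : Ω' → ℝ}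

lemma extExpectation_eq_integral {f : Ω → ℝ} (hf : Integrable f P) :
    extExpectation P f = ((∫ ω, f ω ∂P : ℝ) : EReal) := by
  have h1 : ∫⁻ ω, ENNReal.ofReal (f ω) ∂P ≠ ⊤ := hf.lintegral_lt_top.ne
  have h2 : ∫⁻ ω, ENNReal.ofReal (-f ω) ∂P ≠ ⊤ := hf.neg.lintegral_lt_top.ne
  rw [extExpectation, integral_eq_lintegral_pos_part_sub_lintegral_neg_part hf, EReal.coe_sub,
    EReal.coe_ennreal_toReal h1, EReal.coe_ennreal_toReal h2]

variable [IsProbabilityMeasure P] [IsProbabilityMeasure P']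

lemma integrable_max_const (hX : Integrable X P) (c : ℝ) : Integrable (fun ω => max (X ω) c) P :=
  hX.sup (integrable_const c)

lemma tendsto_integral_max_neg_natCast (hX : Integrable X P) :
    Filter.Tendsto (fun n : ℕ => ∫ ω, max (X ω) (-(n : ℝ)) ∂P) Filter.atTop (nhds (∫ ω, X ω ∂P)) := by
  refine tendsto_integral_of_dominated_convergence (fun ω => |X ω|)
    (fun n => (integrable_max_const hX _).aestronglyMeasurable) hX.abs
    (fun n => ae_of_all _ fun ω => ?_) (ae_of_all _ fun ω => ?_)
  · have : -(n : ℝ) ≤ 0 := by simp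
    rw [Real.norm_eq_abs, abs_le]
    exact ⟨(neg_abs_le _).trans (le_max_left _ _),
      max_le (le_abs_self _) (this.trans (abs_nonneg _))⟩
  · refine tendsto_const_nhds.congr' ?_
    filter_upwards [Filter.eventually_ge_atTop ⌈|X ω|⌉₊] with n hn
    have := abs_le.1 (Nat.ceil_le.1 hn)
    rw [max_eq_left this.1]

lemma integral_le_of_integral_max_le (hX : Integrable X P) (hY : Integrable Y P')
    (h : ∀ c, ∫ ω, max (X ω) c ∂P ≤ ∫ ω, max (Y ω) c ∂P') : ∫ ω, X ω ∂P ≤ ∫ ω, Y ω ∂P' :=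
  le_of_tendsto_of_tendsto' (tendsto_integral_max_neg_natCast hX)
    (tendsto_integral_max_neg_natCast hY) fun _ => h _

lemma integrable_max_affine (hX : Integrable X P) (A B : ℝ) :
    Integrable (fun ω => max (A + B * X ω) 0) P :=
  integrable_max_const ((integrable_const _).add (hX.const_mul _)) 0

lemma integral_max_affine_le (hX : Integrable X P) (hY : Integrable Y P')
    (h : ∀ c, ∫ ω, max (X ω) c ∂P ≤ ∫ ω, max (Y ω) c ∂P') (A : ℝ) {B : ℝ} (hB : 0 ≤ B) :
    ∫ ω, max (A + B * X ω) 0 ∂P ≤ ∫ ω, max (A + B * Y ω) 0 ∂P' := by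
  rcases hB.eq_or_lt with rfl | hB
  · simp
  -- For B > 0 the kink sits at -A/B, which is the truncation level to use.
  have e : ∀ x, max (A + B * x) 0 = A + B * max x (-A / B) := fun x => by
    rw [mul_max_of_nonneg _ _ hB.le, mul_div_cancel₀ _ hB.ne', ← max_add_add_left, add_neg_cancel]
  simp_rw [e]
  rw [integral_add (integrable_const _) ((integrable_max_const hX _).const_mul _),
    integral_add (integrable_const _) ((integrable_max_const hY _).const_mul _),
    integral_const_mul, integral_const_mul]
  simp only [integral_const, probReal_univ, one_smul]
  gcongr
  exact h _

lemma integrable_tangentEnvelope (hX : Integrable X P) (g s : ℝ → ℝ) (a h : ℝ) (n : ℕ) :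
    Integrable (fun ω => tangentEnvelope g s a h n (X ω)) P := by
  have hl : ∀ A B C : ℝ, Integrable (fun ω => A + B * (X ω - C)) P := fun A B C =>
    (integrable_const _).add ((hX.sub (integrable_const _)).const_mul _)
  exact (hl _ _ _).add (integrable_finsetSum _ fun k _ =>
    integrable_max_const ((hl _ _ _).sub (hl _ _ _)) 0)

/-- The slopes at the nodes are nonnegative and non-decreasing. The initial tangent thus needs only
the order of the means, and each further summand is a positive part (A + Bx)⁺ with B ≥ 0. -/
lemma integral_tangentEnvelope_le (hX : Integrable X P) (hY : Integrable Y P')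
    (hXY : ∀ c, ∫ ω, max (X ω) c ∂P ≤ ∫ ω, max (Y ω) c ∂P') {g s : ℝ → ℝ}
    (hs : ∀ q y, g q + s q * (y - q) ≤ g y) (hg : Monotone g) (a : ℝ) {h : ℝ} (hh : 0 ≤ h) (n : ℕ) :
    ∫ ω, tangentEnvelope g s a h n (X ω) ∂P ≤ ∫ ω, tangentEnvelope g s a h n (Y ω) ∂P' := by
  induction n with
  | zero =>
    have e : ∀ x, tangentEnvelope g s a h 0 x = (g a - s a * a) + s a * x := fun x => by
      simp [tangentEnvelope]; ring
    simp_rw [e]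
    rw [integral_add (integrable_const _) (hX.const_mul _),
      integral_add (integrable_const _) (hY.const_mul _), integral_const_mul, integral_const_mul]
    simp only [integral_const, probReal_univ, one_smul]
    have := integral_le_of_integral_max_le hX hY hXY
    have := subgradient_nonneg hs hg a
    gcongr
  | succ n ih =>
    set q := a + n * h with hq
    set q' := a + (n + 1 : ℕ) * h with hq'
    have hqq' : q ≤ q' := by rw [hq, hq']; push_cast; linarith
    have hsq := monotone_of_subgradient hs hqq'
    set A := g q' - s q' * q' - (g q - s q * q)
    have e : ∀ x, tangentEnvelope g s a h (n + 1) x =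
        tangentEnvelope g s a h n x + max (A + (s q' - s q) * x) 0 := fun x => by
      rw [tangentEnvelope, Finset.sum_range_succ, ← add_assoc, ← tangentEnvelope]
      congr 2
      ring
    simp_rw [e]
    rw [integral_add (integrable_tangentEnvelope hX g s a h n) (integrable_max_affine hX _ _),
      integral_add (integrable_tangentEnvelope hY g s a h n) (integrable_max_affine hY _ _)]
    exact add_le_add ih (integral_max_affine_le hX hY hXY A (sub_nonneg.2 hsq))

/-- If `E[max(X, c)] ≤ E[max(Y, c)]` for all `c`, then `X` is smaller than `Y` in the increasing
convex order. -/
theorem integrable_and_integral_comp_le_of_integral_max_le (hX : Integrable X P)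
    (hY : Integrable Y P') (hXY : ∀ c, ∫ ω, max (X ω) c ∂P ≤ ∫ ω, max (Y ω) c ∂P') {g : ℝ → ℝ}
    (hg : Monotone g) (hconv : ConvexOn ℝ Set.univ g) (hgY : Integrable (fun ω => g (Y ω)) P') :
    Integrable (fun ω => g (X ω)) P ∧ ∫ ω, g (X ω) ∂P ≤ ∫ ω, g (Y ω) ∂P' := by
  obtain ⟨s, hs⟩ := hconv.exists_subgradient
  have hc : Continuous g := by
    rw [← continuousOn_univ]
    exact hconv.continuousOn isOpen_univ
  set F : ℕ → ℝ → ℝ := fun j =>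
    tangentEnvelope g s (-j) (1 / ((j : ℝ) + 1)) (2 * (j * (j + 1)))
  have hFg : ∀ j x, F j x ≤ g x := fun j x => tangentEnvelope_le hs _ (by positivity) _ x
  -- The node of index j(j+1) is 0, so the tangent at 0 is a common affine minorant of all
  -- envelopes; subtracting it makes Fatou's lemma applicable.
  have hF0 : ∀ j x, g 0 + s 0 * x ≤ F j x := fun j x => by
    have h := tangent_le_tangentEnvelope g s (-j) (1 / ((j : ℝ) + 1))
      (show j * (j + 1) ≤ 2 * (j * (j + 1)) by omega) x
    have e : -(j : ℝ) + ((j * (j + 1) : ℕ) : ℝ) * (1 / ((j : ℝ) + 1)) = 0 := by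
      push_cast; field_simp; ring
    rwa [e, sub_zero] at h
  have hFX : ∀ j, Integrable (fun ω => F j (X ω)) P := fun j =>
    integrable_tangentEnvelope hX _ _ _ _ _
  have hFle : ∀ j, ∫ ω, F j (X ω) ∂P ≤ ∫ ω, g (Y ω) ∂P' := fun j =>
    (integral_tangentEnvelope_le hX hY hXY hs hg _ (by positivity) _).trans
      (integral_mono (integrable_tangentEnvelope hY _ _ _ _ _) hgY fun ω => hFg j _)
  have hl : Integrable (fun ω => g 0 + s 0 * X ω) P := (integrable_const _).add (hX.const_mul _)
  set I := ∫ ω, g (Y ω) ∂P' - ∫ ω, (g 0 + s 0 * X ω) ∂P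
  have hI : 0 ≤ I := sub_nonneg.2 ((integral_mono hl (hFX 0) fun ω => hF0 0 _).trans (hFle 0))
  have hmeas : AEStronglyMeasurable (fun ω => g (X ω) - (g 0 + s 0 * X ω)) P :=
    (hc.comp_aestronglyMeasurable hX.aestronglyMeasurable).sub hl.aestronglyMeasurable
  have hpos : ∀ ω, 0 ≤ g (X ω) - (g 0 + s 0 * X ω) := fun ω =>
    sub_nonneg.2 ((hF0 0 _).trans (hFg 0 _))
  have hfatou : ∫⁻ ω, ENNReal.ofReal (g (X ω) - (g 0 + s 0 * X ω)) ∂P ≤ ENNReal.ofReal I := by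
    have hlim : ∀ ω, ENNReal.ofReal (g (X ω) - (g 0 + s 0 * X ω)) =
        Filter.liminf (fun j => ENNReal.ofReal (F j (X ω) - (g 0 + s 0 * X ω))) Filter.atTop :=
      fun ω => (ENNReal.tendsto_ofReal
        ((tendsto_tangentEnvelope hs hg hc (X ω)).sub_const _)).liminf_eq.symm
    simp_rw [hlim]
    refine (lintegral_liminf_le' fun j =>
      ((hFX j).sub hl).aestronglyMeasurable.aemeasurable.ennreal_ofReal).trans ?_
    refine Filter.liminf_le_of_le (by isBoundedDefault) fun b hb => ?_
    obtain ⟨j, hj⟩ := hb.exists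
    refine hj.trans ?_
    rw [← ofReal_integral_eq_lintegral_ofReal ((hFX j).sub hl)
      (ae_of_all _ fun ω => sub_nonneg.2 (hF0 j _))]
    refine ENNReal.ofReal_le_ofReal ?_
    rw [integral_sub' (hFX j) hl]
    exact sub_le_sub_right (hFle j) _
  have hint : Integrable (fun ω => g (X ω) - (g 0 + s 0 * X ω)) P := by
    refine ⟨hmeas, ?_⟩
    rw [hasFiniteIntegral_iff_ofReal (ae_of_all _ hpos)]
    exact hfatou.trans_lt ENNReal.ofReal_lt_top
  have hgX : Integrable (fun ω => g (X ω)) P :=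
    (hint.add hl).congr (ae_of_all _ fun ω => sub_add_cancel _ _)
  refine ⟨hgX, ?_⟩
  rw [← ofReal_integral_eq_lintegral_ofReal hint (ae_of_all _ hpos),
    ENNReal.ofReal_le_ofReal_iff hI, integral_sub hgX hl] at hfatou
  linarith

lemma lintegral_neg_comp_lt_top (hX : Integrable X P) {g : ℝ → ℝ}
    (hconv : ConvexOn ℝ Set.univ g) : ∫⁻ ω, ENNReal.ofReal (-g (X ω)) ∂P < ⊤ := by
  obtain ⟨s, hs⟩ := hconv.exists_subgradient
  have hl : Integrable (fun ω => -(g 0 + s 0 * X ω)) P :=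
    ((integrable_const _).add (hX.const_mul _)).neg
  refine (lintegral_mono fun ω => ENNReal.ofReal_le_ofReal ?_).trans_lt hl.lintegral_lt_top
  have := hs 0 (X ω)
  rw [sub_zero] at this
  linarith

/-- The increasing convex order, for expectations with values in `(-∞, ∞]`. -/
theorem extExpectation_comp_le_of_integral_max_le (hX : Integrable X P) (hY : Integrable Y P')
    (hXY : ∀ c, ∫ ω, max (X ω) c ∂P ≤ ∫ ω, max (Y ω) c ∂P') {g : ℝ → ℝ} (hg : Monotone g)
    (hconv : ConvexOn ℝ Set.univ g) :
    extExpectation P (fun ω => g (X ω)) ≤ extExpectation P' (fun ω => g (Y ω)) := by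
  have hneg := lintegral_neg_comp_lt_top hY hconv
  by_cases htop : ∫⁻ ω, ENNReal.ofReal (g (Y ω)) ∂P' = ⊤
  · have : extExpectation P' (fun ω => g (Y ω)) = ⊤ := by
      rw [extExpectation, htop, ← ENNReal.coe_toNNReal hneg.ne]
      rfl
    rw [this]
    exact le_top
  have hgY : Integrable (fun ω => g (Y ω)) P' := by
    refine ⟨(hg.measurable.comp_aemeasurable hY.aemeasurable).aestronglyMeasurable, ?_⟩
    have habs : ∀ x : ℝ, ‖x‖ₑ = ENNReal.ofReal x + ENNReal.ofReal (-x) := fun x => by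
      rw [← ofReal_norm, Real.norm_eq_abs]
      rcases le_total 0 x with h | h
      · rw [abs_of_nonneg h, ENNReal.ofReal_of_nonpos (neg_nonpos.2 h), add_zero]
      · rw [abs_of_nonpos h, ENNReal.ofReal_of_nonpos h, zero_add]
    rw [HasFiniteIntegral]
    simp_rw [habs]
    have hm : AEMeasurable (fun ω => ENNReal.ofReal (g (Y ω))) P' :=
      (hg.measurable.comp_aemeasurable hY.aemeasurable).ennreal_ofReal
    rw [lintegral_add_left' hm]
    exact ENNReal.add_lt_top.2 ⟨lt_top_iff_ne_top.2 htop, hneg⟩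
  obtain ⟨hgX, hle⟩ := integrable_and_integral_comp_le_of_integral_max_le hX hY hXY hg hconv hgY
  rw [extExpectation_eq_integral hgX, extExpectation_eq_integral hgY]
  exact EReal.coe_le_coe_iff.2 hle

end IncreasingConvexOrder

/-! ### Gaussian processes: finite-dimensional comparison and an integrable envelope. -/

section Processes

variable {S Ω Ω' : Type*} [MeasurableSpace Ω] [MeasurableSpace Ω'] {P : Measure Ω} {P' : Measure Ω'}

lemma ProbabilityTheory.IsGaussianProcess.hasGaussianLaw_comp {X : S → Ω → ℝ}
    (hX : IsGaussianProcess X P) {ι : Type*} [Fintype ι] (d : ι → S) :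
    HasGaussianLaw (fun ω i => X (d i) ω) P := by
  classical
  let I : Finset S := Finset.univ.image d
  let L : (I → ℝ) →L[ℝ] (ι → ℝ) :=
    ContinuousLinearMap.pi fun i => ContinuousLinearMap.proj
      (⟨d i, Finset.mem_image_of_mem d (Finset.mem_univ i)⟩ : I)
  exact (hX.hasGaussianLaw I).map L

/-- The **Sudakov–Fernique inequality** for Gaussian processes with a drift. -/
theorem integral_sup'_process_le {X : S → Ω → ℝ} {Y : S → Ω' → ℝ} (hX : IsGaussianProcess X P)
    (hY : IsGaussianProcess Y P') (hX0 : ∀ s, ∫ ω, X s ω ∂P = 0) (hY0 : ∀ s, ∫ ω, Y s ω ∂P' = 0)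
    (hXY : ∀ s t, ∫ ω, (X s ω - X t ω) ^ 2 ∂P ≤ ∫ ω, (Y s ω - Y t ω) ^ 2 ∂P') {ι : Type*}
    [Fintype ι] [Nonempty ι] (d : ι → S) (m : ι → ℝ) :
    ∫ ω, Finset.univ.sup' Finset.univ_nonempty (fun i => m i + X (d i) ω) ∂P ≤
      ∫ ω, Finset.univ.sup' Finset.univ_nonempty (fun i => m i + Y (d i) ω) ∂P' := by
  have lX := hX.hasGaussianLaw_comp d
  have lY := hY.hasGaussianLaw_comp d
  have := lX.isGaussian_map
  have := lY.isGaussian_map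
  have hmX := lX.aemeasurable
  have hmY := lY.aemeasurable
  have hsup : Continuous fun x : ι → ℝ => Finset.univ.sup' Finset.univ_nonempty (m + x) :=
    lipschitzWith_sup'_univ.continuous.comp (by fun_prop)
  have key := integral_sup'_le_of_increments_le (μ := P.map fun ω i => X (d i) ω)
    (ν := P'.map fun ω i => Y (d i) ω) (fun i => ?_) (fun i => ?_) (fun i j => ?_) m
  · rwa [integral_map hmX hsup.aestronglyMeasurable, integral_map hmY hsup.aestronglyMeasurable]
      at key
  · rw [integral_map hmX (measurable_pi_apply i).aestronglyMeasurable]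
    exact hX0 _
  · rw [integral_map hmY (measurable_pi_apply i).aestronglyMeasurable]
    exact hY0 _
  · rw [integral_map hmX (by fun_prop), integral_map hmY (by fun_prop)]
    exact hXY _ _

/-- Fernique's theorem with a bound that depends only on a level `a` such that the norm is at
most `a` with probability at least `3 / 4`. -/
lemma exists_lintegral_norm_le_of_isGaussian {a : ℝ} (ha : 0 < a) :
    ∃ M : ℝ≥0∞, M < ⊤ ∧ ∀ (n : ℕ) (μ : Measure (Fin n → ℝ)) [IsGaussian μ],
      (∀ i, ∫ x, x i ∂μ = 0) → 3 / 4 ≤ μ {x | ‖x‖ ≤ a} →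
      ∫⁻ x, ENNReal.ofReal ‖x‖ ∂μ ≤ M := by
  -- The level 3/4 lies strictly between 1/2 and 1, as Fernique's estimate requires. Fixing it makes
  -- the bound independent of the dimension and of the measure.
  have hc1 : (2 : ℝ≥0∞)⁻¹ < 3 / 4 := by
    rw [← ENNReal.toReal_lt_toReal (by simp) (by finiteness)]
    norm_num
  have hc2 : (3 / 4 : ℝ≥0∞) < 1 := by
    rw [← ENNReal.toReal_lt_toReal (by finiteness) (by simp)]
    norm_num
  have hc3 : ((3 / 4 : ℝ≥0∞) / (1 - 3 / 4)).toReal = 3 := by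
    rw [ENNReal.toReal_div, ENNReal.toReal_sub_of_le hc2.le (by simp)]
    norm_num
  set δ := Fernique.logRatio (3 / 4) * a⁻¹ ^ 2
  have hδ : 0 < δ := mul_pos (Fernique.logRatio_pos hc1 hc2) (by positivity)
  refine ⟨ENNReal.ofReal (1 + δ⁻¹) * (ENNReal.ofReal (Real.exp (Fernique.logRatio (3 / 4))) +
    ∑' n : ℕ, ENNReal.ofReal (Real.exp (-2⁻¹ *
      Real.log ((3 / 4 : ℝ≥0∞) / (1 - 3 / 4)).toReal * 2 ^ n))), ?_, fun n μ _ hμ hμa => ?_⟩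
  · refine ENNReal.mul_lt_top ENNReal.ofReal_lt_top
      (ENNReal.add_lt_top.2 ⟨ENNReal.ofReal_lt_top, ?_⟩)
    refine Summable.tsum_ofReal_lt_top <|
      Real.summable_exp_nat_mul_of_ge ?_ (fun i => mod_cast (Nat.lt_pow_self (by simp)).le)
    rw [hc3]
    exact mul_neg_of_neg_of_pos (by simp) (Real.log_pos (by norm_num))
  · have hid : ∫ x, id x ∂μ = 0 := by
      ext i
      simp only [id]
      rw [eval_integral fun i => IsGaussian.integrable_eval μ i]
      exact hμ i
    refine le_trans ?_ (mul_le_mul_right (lintegral_exp_mul_sq_norm_le_of_map_rotation_eq_self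
      (IsGaussian.map_rotation_eq_self hid _) hμa hc1) _)
    rw [← lintegral_const_mul' _ _ ENNReal.ofReal_ne_top]
    refine lintegral_mono fun x => ?_
    rw [← ENNReal.ofReal_mul (by positivity)]
    refine ENNReal.ofReal_le_ofReal ?_
    have h1 := Real.add_one_le_exp (δ * ‖x‖ ^ 2)
    have h2 : ‖x‖ ≤ 1 + ‖x‖ ^ 2 := by nlinarith [sq_nonneg (‖x‖ - 1)]
    calc ‖x‖ ≤ 1 + ‖x‖ ^ 2 := h2
      _ ≤ (1 + δ⁻¹) * (δ * ‖x‖ ^ 2 + 1) := by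
        have : (1 + δ⁻¹) * (δ * ‖x‖ ^ 2 + 1) = 1 + ‖x‖ ^ 2 + δ⁻¹ + δ * ‖x‖ ^ 2 := by
          field_simp; ring
        rw [this]
        have : 0 ≤ δ⁻¹ + δ * ‖x‖ ^ 2 := by positivity
        linarith
      _ ≤ _ := by gcongr

/-- A centered Gaussian sequence that is almost surely bounded is dominated by an integrable random
variable. -/
theorem exists_integrable_bound_of_gaussian [IsProbabilityMeasure P] {X : S → Ω → ℝ}
    (hX : IsGaussianProcess X P) (hX0 : ∀ s, ∫ ω, X s ω ∂P = 0) (d : ℕ → S)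
    (hb : ∀ᵐ ω ∂P, ∃ C, ∀ i, |X (d i) ω| ≤ C) :
    ∃ Z : Ω → ℝ, Integrable Z P ∧ ∀ᵐ ω ∂P, ∀ i, |X (d i) ω| ≤ Z ω := by
  set A : ℕ → Set Ω := fun k => {ω | ∀ i, |X (d i) ω| ≤ k}
  have hA : Monotone A := fun k l hkl ω hω i => (hω i).trans (Nat.cast_le.2 hkl)
  have hU : P (⋃ k, A k) = 1 := by
    rw [← measure_univ (μ := P)]
    refine measure_congr ?_
    rw [ae_eq_univ]
    refine measure_mono_null (fun ω hω => ?_) hb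
    rintro ⟨C, hC⟩
    obtain ⟨k, hk⟩ := exists_nat_ge C
    exact hω (Set.mem_iUnion.2 ⟨k, fun i => (hC i).trans hk⟩)
  -- Almost sure boundedness supplies a single level k valid for all coordinates at once, so the
  -- Fernique bound is uniform in the number of coordinates and survives monotone convergence.
  obtain ⟨k, hk⟩ : ∃ k, 3 / 4 < P (A k) := by
    have hlim := tendsto_measure_iUnion_atTop (μ := P) hA
    rw [hU] at hlim
    have hc : (3 / 4 : ℝ≥0∞) < 1 := by
      rw [← ENNReal.toReal_lt_toReal (by finiteness) (by simp)]
      norm_num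
    exact (hlim.eventually (lt_mem_nhds hc)).exists
  obtain ⟨M, hM, hbound⟩ := exists_lintegral_norm_le_of_isGaussian (a := (k : ℝ) + 1) (by positivity)
  set V : (n : ℕ) → Ω → Fin n → ℝ := fun n ω i => X (d i) ω
  have lV : ∀ n, HasGaussianLaw (V n) P := fun n => hX.hasGaussianLaw_comp fun i : Fin n => d i
  have hVm : ∀ n, AEMeasurable (fun ω => ENNReal.ofReal ‖V n ω‖) P := fun n =>
    (lV n).aemeasurable.norm.ennreal_ofReal
  have hV : ∀ n, ∫⁻ ω, ENNReal.ofReal ‖V n ω‖ ∂P ≤ M := fun n => by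
    have := (lV n).isGaussian_map
    have h := hbound n (P.map (V n)) (fun i => ?_) ?_
    · rwa [lintegral_map' (by fun_prop) (lV n).aemeasurable] at h
    · rw [integral_map (lV n).aemeasurable (measurable_pi_apply i).aestronglyMeasurable]
      exact hX0 _
    · rw [Measure.map_apply_of_aemeasurable (lV n).aemeasurable
        (measurableSet_le measurable_norm measurable_const)]
      refine hk.le.trans (measure_mono fun ω hω => ?_)
      refine (pi_norm_le_iff_of_nonneg (by positivity)).2 fun i => ?_
      exact (hω i).trans (by simp)
  have hVmono : ∀ ω, Monotone fun n => ENNReal.ofReal ‖V n ω‖ := fun ω n l hnl => by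
    refine ENNReal.ofReal_le_ofReal ((pi_norm_le_iff_of_nonneg (norm_nonneg _)).2 fun i => ?_)
    exact norm_le_pi_norm (V l ω) (Fin.castLE hnl i)
  have hfin : ∫⁻ ω, ⨆ n, ENNReal.ofReal ‖V n ω‖ ∂P < ⊤ := by
    rw [lintegral_iSup' hVm (ae_of_all _ hVmono)]
    exact (iSup_le hV).trans_lt hM
  have hmeas : AEMeasurable (fun ω => ⨆ n, ENNReal.ofReal ‖V n ω‖) P := AEMeasurable.iSup hVm
  refine ⟨fun ω => (⨆ n, ENNReal.ofReal ‖V n ω‖).toReal,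
    integrable_toReal_of_lintegral_ne_top hmeas hfin.ne, ?_⟩
  filter_upwards [ae_lt_top' hmeas hfin.ne] with ω hω i
  refine (ENNReal.ofReal_le_iff_le_toReal hω.ne).1 ?_
  refine le_trans (ENNReal.ofReal_le_ofReal ?_) (le_iSup (fun n => ENNReal.ofReal ‖V n ω‖) (i + 1))
  exact norm_le_pi_norm (V (i + 1) ω) (Fin.last i)

end Processes

/-! ### Suprema of continuous functions over [0, T]. -/

section SupIcc

variable {T : ℝ≥0} {f : ℝ≥0 → ℝ}

lemma bddAbove_range_of_continuousOn (hf : ContinuousOn f (Set.Icc 0 T)) :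
    BddAbove (Set.range fun t : Set.Icc (0 : ℝ≥0) T => f t) := by
  have := (isCompact_Icc (a := (0 : ℝ≥0)) (b := T)).bddAbove_image hf
  rwa [Set.image_eq_range] at this

lemma le_supIcc (hf : ContinuousOn f (Set.Icc 0 T)) {t : ℝ≥0} (ht : t ∈ Set.Icc 0 T) :
    f t ≤ supIcc T f :=
  le_ciSup (bddAbove_range_of_continuousOn hf) (⟨t, ht⟩ : Set.Icc (0 : ℝ≥0) T)

lemma supIcc_le {C : ℝ} (h : ∀ t ∈ Set.Icc 0 T, f t ≤ C) : supIcc T f ≤ C :=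
  haveI : Nonempty (Set.Icc (0 : ℝ≥0) T) := ⟨⟨0, by simp⟩⟩
  ciSup_le fun t => h t t.2

lemma supIcc_max (hf : ContinuousOn f (Set.Icc 0 T)) (c : ℝ) :
    supIcc T (fun t => max (f t) c) = max (supIcc T f) c := by
  have hc : ContinuousOn (fun t => max (f t) c) (Set.Icc 0 T) := ContinuousOn.sup hf continuousOn_const
  refine le_antisymm (supIcc_le fun t ht => max_le_max_right c (le_supIcc hf ht)) (max_le ?_ ?_)
  · exact supIcc_le fun t ht => (le_max_left _ _).trans (le_supIcc hc ht)
  · exact (le_max_right _ _).trans (le_supIcc hc (t := 0) (by simp))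

/-- A sequence that is dense in `[0, T]`. -/
noncomputable def denseSeqIcc (T : ℝ≥0) (n : ℕ) : ℝ≥0 :=
  haveI : Nonempty (Set.Icc (0 : ℝ≥0) T) := ⟨⟨0, by simp⟩⟩
  (TopologicalSpace.denseSeq (Set.Icc (0 : ℝ≥0) T) n : ℝ≥0)

lemma denseSeqIcc_mem (T : ℝ≥0) (n : ℕ) : denseSeqIcc T n ∈ Set.Icc 0 T := Subtype.property _

lemma exists_lt_denseSeqIcc (hf : ContinuousOn f (Set.Icc 0 T)) {b : ℝ} (hb : b < supIcc T f) :
    ∃ n, b < f (denseSeqIcc T n) := by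
  have : Nonempty (Set.Icc (0 : ℝ≥0) T) := ⟨⟨0, by simp⟩⟩
  obtain ⟨t, ht⟩ := exists_lt_of_lt_ciSup hb
  have hopen : IsOpen {t : Set.Icc (0 : ℝ≥0) T | b < f t} :=
    isOpen_lt continuous_const (continuousOn_iff_continuous_domRestrict.1 hf)
  obtain ⟨n, hn⟩ := (TopologicalSpace.denseRange_denseSeq
    (Set.Icc (0 : ℝ≥0) T)).exists_mem_open hopen ⟨t, ht⟩
  exact ⟨n, hn⟩

lemma le_of_forall_denseSeqIcc_le (hf : ContinuousOn f (Set.Icc 0 T)) {C : ℝ}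
    (h : ∀ n, f (denseSeqIcc T n) ≤ C) {t : ℝ≥0} (ht : t ∈ Set.Icc 0 T) : f t ≤ C := by
  refine (le_supIcc hf ht).trans (le_of_not_gt fun hC => ?_)
  obtain ⟨n, hn⟩ := exists_lt_denseSeqIcc hf hC
  exact (h n).not_gt hn

/-- The index `none` carries the level c, so truncation is part of the finite maximum, which is
taken over a nonempty set even for n = 0. -/
lemma tendsto_sup'_denseSeqIcc (hf : ContinuousOn f (Set.Icc 0 T)) (c : ℝ) :
    Filter.Tendsto (fun n : ℕ => Finset.univ.sup' Finset.univ_nonempty fun o : Option (Fin n) =>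
      o.elim c fun i => f (denseSeqIcc T i)) Filter.atTop
      (nhds (supIcc T fun t => max (f t) c)) := by
  rw [supIcc_max hf]
  refine tendsto_order.2 ⟨fun b hb => ?_, fun b hb => Filter.Eventually.of_forall fun n => ?_⟩
  · rcases lt_max_iff.1 hb with hb | hb
    · obtain ⟨k, hk⟩ := exists_lt_denseSeqIcc hf hb
      filter_upwards [Filter.eventually_gt_atTop k] with n hn
      exact hk.trans_le (Finset.le_sup' (fun o : Option (Fin n) =>
        o.elim c fun i => f (denseSeqIcc T i)) (Finset.mem_univ (some (⟨k, hn⟩ : Fin n))))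
    · exact Filter.Eventually.of_forall fun n => hb.trans_le
        (Finset.le_sup' (fun o : Option (Fin n) => o.elim c fun i => f (denseSeqIcc T i))
          (Finset.mem_univ none))
  · refine lt_of_le_of_lt (Finset.sup'_le _ _ fun o _ => ?_) hb
    cases o with
    | none => exact le_max_right _ _
    | some i => exact (le_supIcc hf (denseSeqIcc_mem T i)).trans (le_max_left _ _)

end SupIcc

/-! ### Comparison of suprema of continuous Gaussian processes. -/

section CenteredGaussian

variable {Ω Ω' : Type*} [MeasurableSpace Ω] [MeasurableSpace Ω'] {P : Measure Ω} {P' : Measure Ω'}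
  {X : ℝ≥0 → Ω → ℝ} {Y : ℝ≥0 → Ω' → ℝ} {C D : ℝ≥0 → ℝ≥0 → ℝ} {T : ℝ≥0} {m : ℝ≥0 → ℝ}

lemma IsCenteredGaussianWithCov.integral_sub_sq (hX : IsCenteredGaussianWithCov X P C)
    (s t : ℝ≥0) : ∫ ω, (X s ω - X t ω) ^ 2 ∂P = C s s + C t t - 2 * C s t := by
  have h2 : ∀ s, MemLp (X s) 2 P := fun s => (hX.isGaussianProcess.hasGaussianLaw_eval s).memLp_two
  have hi : ∀ s t, Integrable (fun ω => X s ω * X t ω) P := fun s t => (h2 s).integrable_mul (h2 t)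
  have e : ∀ ω, (X s ω - X t ω) ^ 2 = X s ω * X s ω + X t ω * X t ω - 2 * (X s ω * X t ω) :=
    fun ω => by ring
  simp_rw [e]
  rw [integral_sub (f := fun ω => X s ω * X s ω + X t ω * X t ω) ((hi s s).add (hi t t)) ((hi s t).const_mul 2), integral_add (hi s s) (hi t t),
    integral_const_mul, hX.covariance_eq, hX.covariance_eq, hX.covariance_eq]

/-- The process `X` together with the zero random variable. -/
def withZero {α : Type*} (X : ℝ≥0 → α → ℝ) (o : Option ℝ≥0) (ω : α) : ℝ := o.elim 0 fun t => X t ω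

lemma withZero_none {α : Type*} (X : ℝ≥0 → α → ℝ) (ω : α) : withZero X none ω = 0 := rfl

lemma withZero_some {α : Type*} (X : ℝ≥0 → α → ℝ) (t : ℝ≥0) (ω : α) : withZero X (some t) ω = X t ω := rfl

lemma ProbabilityTheory.IsGaussianProcess.withZero (hX : IsGaussianProcess X P) :
    IsGaussianProcess (withZero X) P :=
  hX.of_isGaussianProcess fun o => by
    cases o with
    | none => exact ⟨∅, 0, fun ω => rfl⟩
    | some t => exact ⟨{t}, ContinuousLinearMap.proj (⟨t, by simp⟩ : ({t} : Finset ℝ≥0)),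
        fun ω => rfl⟩

lemma ContinuousPathsOn.add (hXc : ContinuousPathsOn T X P) (hm : ContinuousOn m (Set.Icc 0 T)) :
    ∀ᵐ ω ∂P, ContinuousOn (fun t => X t ω + m t) (Set.Icc 0 T) := by
  filter_upwards [hXc] with ω hω
  exact ContinuousOn.add hω hm

/-- The maximum of `c` and the values of `X + m` at the first points of `denseSeqIcc T`. -/
noncomputable def supDense {α : Type*} (X : ℝ≥0 → α → ℝ) (m : ℝ≥0 → ℝ) (T : ℝ≥0) (c : ℝ)
    (n : ℕ) (ω : α) : ℝ :=
  Finset.univ.sup' Finset.univ_nonempty fun o : Option (Fin n) =>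
    o.elim c fun i => X (denseSeqIcc T i) ω + m (denseSeqIcc T i)

lemma supDense_eq {α : Type*} (X : ℝ≥0 → α → ℝ) (m : ℝ≥0 → ℝ) (T : ℝ≥0) (c : ℝ) (n : ℕ) (ω : α) :
    supDense X m T c n ω = Finset.univ.sup' Finset.univ_nonempty fun o : Option (Fin n) =>
      (o.elim c fun i => m (denseSeqIcc T i)) +
        withZero X (o.map fun i => denseSeqIcc T i) ω := by
  refine Finset.sup'_congr _ rfl fun o _ => ?_
  cases o with
  | none => exact (add_zero c).symm
  | some i => exact add_comm _ _

lemma IsCenteredGaussianWithCov.aemeasurable_supDense (hX : IsCenteredGaussianWithCov X P C)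
    (c : ℝ) (n : ℕ) : AEMeasurable (supDense X m T c n) P := by
  refine (lipschitzWith_sup'_univ (ι := Option (Fin n))).continuous.measurable.comp_aemeasurable
    (aemeasurable_pi_lambda _ fun o => ?_)
  cases o with
  | none => exact aemeasurable_const
  | some i => exact (hX.isGaussianProcess.aemeasurable _).add_const _

lemma tendsto_supDense (hXc : ContinuousPathsOn T X P) (hm : ContinuousOn m (Set.Icc 0 T)) (c : ℝ) :
    ∀ᵐ ω ∂P, Filter.Tendsto (fun n => supDense X m T c n ω) Filter.atTop
      (nhds (max (supIcc T fun t => X t ω + m t) c)) := by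
  filter_upwards [hXc.add hm] with ω hω
  rw [← supIcc_max hω]
  exact tendsto_sup'_denseSeqIcc hω c

variable [IsProbabilityMeasure P] [IsProbabilityMeasure P']

/-- An integrable envelope for the drifted process. -/
lemma IsCenteredGaussianWithCov.exists_integrable_envelope (hX : IsCenteredGaussianWithCov X P C)
    (hXc : ContinuousPathsOn T X P) (hm : ContinuousOn m (Set.Icc 0 T)) :
    ∃ Z : Ω → ℝ, Integrable Z P ∧ ∀ᵐ ω ∂P, ∀ t ∈ Set.Icc 0 T, |X t ω + m t| ≤ Z ω := by
  obtain ⟨M, hM⟩ := isCompact_Icc.exists_bound_of_continuousOn hm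
  obtain ⟨Z, hZ, hXZ⟩ := exists_integrable_bound_of_gaussian hX.isGaussianProcess hX.centered
    (denseSeqIcc T) (by
      filter_upwards [hXc] with ω hω
      obtain ⟨K, hK⟩ := isCompact_Icc.exists_bound_of_continuousOn hω
      exact ⟨K, fun i => hK _ (denseSeqIcc_mem T i)⟩)
  refine ⟨fun ω => Z ω + M, hZ.add (integrable_const M), ?_⟩
  filter_upwards [hXc, hXZ] with ω hω hωZ t ht
  refine (abs_add_le _ _).trans (add_le_add ?_ (hM t ht))
  exact le_of_forall_denseSeqIcc_le (f := fun t => |X t ω|) (ContinuousOn.abs hω) hωZ ht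

lemma IsCenteredGaussianWithCov.integrable_supIcc (hX : IsCenteredGaussianWithCov X P C)
    (hXc : ContinuousPathsOn T X P) (hm : ContinuousOn m (Set.Icc 0 T)) :
    Integrable (fun ω => supIcc T fun t => X t ω + m t) P := by
  -- Measurability of an uncountable supremum is obtained almost everywhere: first truncated, as a
  -- limit of finite maxima, then with truncation levels -n.
  have hmax : ∀ c, AEMeasurable (fun ω => max (supIcc T fun t => X t ω + m t) c) P := fun c =>
    aemeasurable_of_tendsto_metrizable_ae _ (fun n => hX.aemeasurable_supDense c n)
      (tendsto_supDense hXc hm c)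
  have hmeas : AEMeasurable (fun ω => supIcc T fun t => X t ω + m t) P := by
    refine aemeasurable_of_tendsto_metrizable_ae Filter.atTop (fun n : ℕ => hmax (-(n : ℝ)))
      (ae_of_all _ fun ω => tendsto_const_nhds.congr' ?_)
    filter_upwards [Filter.eventually_ge_atTop ⌈|supIcc T fun t => X t ω + m t|⌉₊] with n hn
    rw [max_eq_left (abs_le.1 (Nat.ceil_le.1 hn)).1]
  obtain ⟨Z, hZ, hXZ⟩ := hX.exists_integrable_envelope hXc hm
  refine hZ.mono' hmeas.aestronglyMeasurable ?_
  filter_upwards [hXZ, hXc.add hm] with ω hω hωc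
  rw [Real.norm_eq_abs, abs_le]
  have h0 : (0 : ℝ≥0) ∈ Set.Icc 0 T := by simp
  exact ⟨(abs_le.1 (hω 0 h0)).1.trans (le_supIcc hωc h0),
    supIcc_le fun t ht => (abs_le.1 (hω t ht)).2⟩

lemma IsCenteredGaussianWithCov.tendsto_integral_supDense (hX : IsCenteredGaussianWithCov X P C)
    (hXc : ContinuousPathsOn T X P) (hm : ContinuousOn m (Set.Icc 0 T)) (c : ℝ) :
    Filter.Tendsto (fun n => ∫ ω, supDense X m T c n ω ∂P) Filter.atTop
      (nhds (∫ ω, max (supIcc T fun t => X t ω + m t) c ∂P)) := by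
  obtain ⟨Z, hZ, hXZ⟩ := hX.exists_integrable_envelope hXc hm
  refine tendsto_integral_of_dominated_convergence (fun ω => |c| + Z ω)
    (fun n => (hX.aemeasurable_supDense c n).aestronglyMeasurable)
    ((integrable_const _).add hZ) (fun n => ?_) (tendsto_supDense hXc hm c)
  filter_upwards [hXZ] with ω hω
  have hZ0 : 0 ≤ Z ω := (abs_nonneg _).trans (hω 0 (by simp))
  have hc : c ≤ supDense X m T c n ω := Finset.le_sup' (fun o : Option (Fin n) =>
    o.elim c fun i => X (denseSeqIcc T i) ω + m (denseSeqIcc T i)) (Finset.mem_univ none)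
  rw [Real.norm_eq_abs, abs_le]
  refine ⟨by linarith [neg_abs_le c], Finset.sup'_le _ _ fun o _ => ?_⟩
  cases o with
  | none => exact (le_abs_self c).trans (le_add_of_nonneg_right hZ0)
  | some i =>
    have := (abs_le.1 (hω _ (denseSeqIcc_mem T i))).2
    exact this.trans (le_add_of_nonneg_left (abs_nonneg c))

/-- Comparison of the truncated suprema of two continuous drifted Gaussian processes. -/
theorem integral_max_supIcc_le (hX : IsCenteredGaussianWithCov X P C)
    (hY : IsCenteredGaussianWithCov Y P' D) (hXc : ContinuousPathsOn T X P)
    (hYc : ContinuousPathsOn T Y P') (hvar : ∀ t, C t t ≤ D t t)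
    (hincr : ∀ s t, C s s + C t t - 2 * C s t ≤ D s s + D t t - 2 * D s t)
    (hm : ContinuousOn m (Set.Icc 0 T)) (c : ℝ) :
    ∫ ω, max (supIcc T fun t => X t ω + m t) c ∂P ≤
      ∫ ω, max (supIcc T fun t => Y t ω + m t) c ∂P' := by
  refine le_of_tendsto_of_tendsto' (hX.tendsto_integral_supDense hXc hm c)
    (hY.tendsto_integral_supDense hYc hm c) fun n => ?_
  simp_rw [supDense_eq]
  refine integral_sup'_process_le hX.isGaussianProcess.withZero hY.isGaussianProcess.withZero
    (fun o => ?_) (fun o => ?_) (fun o o' => ?_) _ _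
  · cases o with
    | none => simp only [withZero_none, integral_zero]
    | some t => exact hX.centered t
  · cases o with
    | none => simp only [withZero_none, integral_zero]
    | some t => exact hY.centered t
  -- Increments against the adjoined zero variable are variances, covered by `hvar`; the remaining
  -- ones are covered by `hincr`.
  · have hX2 : ∀ t, ∫ ω, X t ω ^ 2 ∂P = C t t := fun t => by
      simp_rw [sq]; exact hX.covariance_eq t t
    have hY2 : ∀ t, ∫ ω, Y t ω ^ 2 ∂P' = D t t := fun t => by
      simp_rw [sq]; exact hY.covariance_eq t t
    cases o with
    | none =>
      cases o' with
      | none => simp only [withZero_none, le_refl, sub_self, ne_eq, OfNat.ofNat_ne_zero,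
          not_false_eq_true, zero_pow, integral_zero]
      | some t =>
        simpa only [withZero_none, withZero_some, zero_sub, neg_sq, hX2, hY2] using hvar t
    | some s =>
      cases o' with
      | none => simpa only [withZero_none, withZero_some, sub_zero, hX2, hY2] using hvar s
      | some t =>
        simp only [withZero_some]
        rw [hX.integral_sub_sq, hY.integral_sub_sq]
        exact hincr s t

end CenteredGaussian

/-! ### Integrated tails and the final assembly. -/

/-- The layer-cake formula for the excess over t, after translating the integration variable by t.
-/
lemma lintegral_measure_lt_Ioi_eq {Ω : Type*} [MeasurableSpace Ω] {P : Measure Ω}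
    [IsProbabilityMeasure P] {X : Ω → ℝ} (hX : Integrable X P) (t : ℝ) :
    ∫⁻ u in Set.Ioi t, P {ω | u < X ω} = ENNReal.ofReal (∫ ω, max (X ω - t) 0 ∂P) := by
  have hi : Integrable (fun ω => max (X ω - t) 0) P :=
    integrable_max_const (hX.sub (integrable_const t)) 0
  have h0 : 0 ≤ᵐ[P] fun ω => max (X ω - t) 0 := ae_of_all _ fun ω => le_max_right _ _
  rw [ofReal_integral_eq_lintegral_ofReal hi h0, lintegral_eq_lintegral_meas_lt P h0
    hi.aestronglyMeasurable.aemeasurable]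
  have e : ∫⁻ u in Set.Ioi t, P {ω | u < X ω} =
      ∫⁻ v in Set.Ioi (0 : ℝ), P {ω | v + t < X ω} := by
    have h := (measurePreserving_add_right volume t).setLIntegral_comp_preimage_emb
      (measurableEmbedding_addRight t) (fun u : ℝ => P {ω | u < X ω}) (Set.Ioi t)
    rw [← h]
    simp
  rw [e]
  refine setLIntegral_congr_fun measurableSet_Ioi fun v hv => ?_
  congr 1
  ext ω
  have hv' : ¬ v < 0 := not_lt.2 (le_of_lt hv)
  simp only [Set.mem_ofPred_eq, lt_max_iff, hv', or_false, lt_sub_iff_add_lt]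

lemma IsFBM.const_mul {Ω : Type*} [MeasurableSpace Ω] {P : Measure Ω} {H : ℝ} {B : ℝ≥0 → Ω → ℝ}
    (hB : IsFBM H B P) (a : ℝ) :
    IsCenteredGaussianWithCov (fun t ω => a * B t ω) P fun s t => a ^ 2 * fbmCov H s t where
  isGaussianProcess := hB.isGaussianProcess.smul fun _ => a
  centered t := by rw [integral_const_mul, hB.centered, mul_zero]
  covariance_eq s t := by
    rw [← hB.covariance_eq s t, ← integral_const_mul]
    exact integral_congr_ae (ae_of_all _ fun ω => by ring)

theorem theorem2p12
    {Ω Ω' : Type*} [MeasurableSpace Ω] [MeasurableSpace Ω']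
    (P : Measure Ω) [IsProbabilityMeasure P] (P' : Measure Ω') [IsProbabilityMeasure P']
    (H K : ℝ) (hH0 : 0 < H) (hH1 : H < 1) (hK0 : 0 < K) (hK1 : K ≤ 1)
    (T : ℝ≥0)
    (W : ℝ≥0 → Ω → ℝ) (hW : IsBifBM H K W P) (hWc : ContinuousPathsOn T W P)
    (B : ℝ≥0 → Ω' → ℝ) (hB : IsFBM (H * K) B P') (hBc : ContinuousPathsOn T B P')
    (Y : ℝ≥0 → Ω' → ℝ) (hY : ∀ t ω, Y t ω = (2 : ℝ) ^ (-K / 2) * B t ω) :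
    -- drifted processes, truncated below by a constant
    (∀ m : ℝ≥0 → ℝ, ContinuousOn m (Set.Icc 0 T) → ∀ c : ℝ,
      Integrable (fun ω => supIcc T (fun t => max (W t ω + m t) c)) P ∧
      Integrable (fun ω => supIcc T (fun t => max (Y t ω + m t) c)) P' ∧
      ∫ ω, supIcc T (fun t => max (Y t ω + m t) c) ∂P' ≤
        ∫ ω, supIcc T (fun t => max (W t ω + m t) c) ∂P) ∧
    -- non-decreasing convex functions of the suprema; the expectations lie in `(-∞, ∞]`
    (∀ m : ℝ≥0 → ℝ, ContinuousOn m (Set.Icc 0 T) →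
      ∀ g : ℝ → ℝ, Monotone g → ConvexOn ℝ Set.univ g →
      ∫⁻ ω, ENNReal.ofReal (-g (supIcc T (fun t => W t ω + m t))) ∂P < ⊤ ∧
      ∫⁻ ω, ENNReal.ofReal (-g (supIcc T (fun t => Y t ω + m t))) ∂P' < ⊤ ∧
      extExpectation P' (fun ω => g (supIcc T (fun t => Y t ω + m t))) ≤
        extExpectation P (fun ω => g (supIcc T (fun t => W t ω + m t)))) ∧
    (∀ t : ℝ, 0 ≤ t → t ≤ T →
      -- integrated tail probabilities
      (∫⁻ u in Set.Ioi t, P {ω | u < supIcc T (fun s => W s ω)} < ⊤ ∧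
        ∫⁻ u in Set.Ioi t, P' {ω | u < supIcc T (fun s => Y s ω)} ≤
          ∫⁻ u in Set.Ioi t, P {ω | u < supIcc T (fun s => W s ω)}) ∧
      -- expected excesses over the level `t`
      (Integrable (fun ω => max (supIcc T (fun s => W s ω) - t) 0) P ∧
        Integrable (fun ω => max (supIcc T (fun s => Y s ω) - t) 0) P' ∧
        ∫ ω, max (supIcc T (fun s => Y s ω) - t) 0 ∂P' ≤
          ∫ ω, max (supIcc T (fun s => W s ω) - t) 0 ∂P) ∧
      -- the two quantities agree for each process, so the last two inequalities are equivalent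
      (∫⁻ u in Set.Ioi t, P {ω | u < supIcc T (fun s => W s ω)} =
        ENNReal.ofReal (∫ ω, max (supIcc T (fun s => W s ω) - t) 0 ∂P)) ∧
      (∫⁻ u in Set.Ioi t, P' {ω | u < supIcc T (fun s => Y s ω)} =
        ENNReal.ofReal (∫ ω, max (supIcc T (fun s => Y s ω) - t) 0 ∂P'))) := by

  obtain rfl : Y = fun t ω => (2 : ℝ) ^ (-K / 2) * B t ω := funext fun t => funext fun ω => hY t ω
  have hYG := hB.const_mul ((2 : ℝ) ^ (-K / 2))
  have hsq : ((2 : ℝ) ^ (-K / 2)) ^ 2 = (2 : ℝ) ^ (-K) := by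
    rw [← Real.rpow_natCast, ← Real.rpow_mul (by norm_num)]
    congr 1
    push_cast
    ring
  rw [hsq] at hYG
  have hYc : ContinuousPathsOn T (fun t ω => (2 : ℝ) ^ (-K / 2) * B t ω) P' := by
    filter_upwards [hBc] with ω hω
    exact continuousOn_const.mul hω
  set Y : ℝ≥0 → Ω' → ℝ := fun t ω => (2 : ℝ) ^ (-K / 2) * B t ω
  have hWG : IsCenteredGaussianWithCov W P (bifbmCov H K) := hW
  have hcmp : ∀ m : ℝ≥0 → ℝ, ContinuousOn m (Set.Icc 0 T) → ∀ c : ℝ,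
      ∫ ω, max (supIcc T fun t => Y t ω + m t) c ∂P' ≤
        ∫ ω, max (supIcc T fun t => W t ω + m t) c ∂P := fun m hm c =>
    integral_max_supIcc_le hYG hWG hYc hWc (fun t => fbmCov_self_le_bifbmCov_self hH0 hK0 t)
      (fun s t => by
        have := fbmCov_increment_le_bifbmCov_increment hH0 hH1 hK0 hK1 s t
        linarith) hm c
  refine ⟨fun m hm c => ?_, fun m hm g hg hconv => ?_, fun t _ _ => ?_⟩
  -- The truncation leaves the supremum only where the path is continuous; elsewhere an unbounded
  -- supremum has a default value, so equality holds almost surely.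
  · have eW : (fun ω => supIcc T fun t => max (W t ω + m t) c) =ᵐ[P]
        fun ω => max (supIcc T fun t => W t ω + m t) c := by
      filter_upwards [hWc.add hm] with ω hω using supIcc_max hω c
    have eY : (fun ω => supIcc T fun t => max (Y t ω + m t) c) =ᵐ[P']
        fun ω => max (supIcc T fun t => Y t ω + m t) c := by
      filter_upwards [hYc.add hm] with ω hω using supIcc_max hω c
    refine ⟨(integrable_congr eW).2 (integrable_max_const (hWG.integrable_supIcc hWc hm) c),
      (integrable_congr eY).2 (integrable_max_const (hYG.integrable_supIcc hYc hm) c), ?_⟩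
    rw [integral_congr_ae eW, integral_congr_ae eY]
    exact hcmp m hm c
  · have iW := hWG.integrable_supIcc hWc hm
    have iY := hYG.integrable_supIcc hYc hm
    exact ⟨lintegral_neg_comp_lt_top iW hconv, lintegral_neg_comp_lt_top iY hconv,
      extExpectation_comp_le_of_integral_max_le iY iW (hcmp m hm) hg hconv⟩
  · have hm : ContinuousOn (fun _ : ℝ≥0 => (0 : ℝ)) (Set.Icc 0 T) := continuousOn_const
    have iW := hWG.integrable_supIcc hWc hm
    have iY := hYG.integrable_supIcc hYc hm
    -- The excess over t is max(x, t) - t, so the comparison is used with zero drift and truncation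
    -- level t.
    have hle := hcmp _ hm t
    simp only [add_zero] at iW iY hle
    have jW : Integrable (fun ω => max (supIcc T (fun s => W s ω) - t) 0) P :=
      integrable_max_const (iW.sub (integrable_const t)) 0
    have jY : Integrable (fun ω => max (supIcc T (fun s => Y s ω) - t) 0) P' :=
      integrable_max_const (iY.sub (integrable_const t)) 0
    have hexc : ∫ ω, max (supIcc T (fun s => Y s ω) - t) 0 ∂P' ≤
        ∫ ω, max (supIcc T (fun s => W s ω) - t) 0 ∂P := by
      have e : ∀ x : ℝ, max (x - t) 0 = max x t - t := fun x => by
        rw [← max_sub_sub_right, sub_self]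
      simp_rw [e]
      rw [integral_sub (integrable_max_const iY t) (integrable_const t),
        integral_sub (integrable_max_const iW t) (integrable_const t)]
      simpa using hle
    rw [lintegral_measure_lt_Ioi_eq iW, lintegral_measure_lt_Ioi_eq iY]
    exact ⟨⟨ENNReal.ofReal_lt_top, ENNReal.ofReal_le_ofReal hexc⟩, ⟨jW, jY, hexc⟩, rfl, rfl⟩
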